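/- Let $V$ be a rational quadratic space with quadratic form $q$ and bilinear form $\beta$, $q(x)=\beta(x,x)/2$, and let $M\subseteq L$ be even non-degenerate lattices of full rank in $V$ (so $M\le L\le L'\le M'$, where $L'=\{x\in V:\beta(x,L)\subseteq\mathbb Z\}$, and all quotients are finite). Write $e(x)=\exp(2\pi i x)$ and let $\mathrm{sig}=b^+-b^-$. Let $\mathbb C[L'/L]$ have the basis $(\mathfrak e_\lambda)_{\lambda\in L'/L}$, and let $\rho_L$ be the Weil representation on it of $\mathrm{Mp}_2(\mathbb Z)$ (pairs $(\gamma,\phi)$ with $\gamma=\begin{pmatrix}a&b\\c&d\end{pmatrix}\in\mathrm{SL}_2(\mathbb Z)$ and $\phi$ a holomorphic square root of $c\tau+d$ on $\mathbb H$), determined by $$\rho_L\left(\begin{pmatrix}1&1\\0&1\end{pmatrix},1\right)\mathfrak e_\lambda=e(q(\lambda))\,\mathfrak e_\lambda,\qquad \rho_L\left(\begin{pmatrix}0&-1\\1&0\end{pmatrix},\sqrt\tau\right)\mathfrak e_\lambda=\frac{e(-\mathrm{sig}/8)}{\sqrt{|L'/L|}}\sum_{\mu\in L'/L}e(-\beta(\lambda,\mu))\,\mathfrak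 e_\mu .$$ For $k\in\frac12\mathbb Z$ let $\mathcal M_{L,k}$ be the space of holomorphic $f:\mathbb H\to\mathbb C[L'/L]$ with $f(\gamma\tau)=\phi(\tau)^{2k}\rho_L(\gamma,\phi)f(\tau)$ for all $(\gamma,\phi)\in\mathrm{Mp}_2(\mathbb Z)$ whose Fourier expansion $f(\tau)=\sum_{\lambda}\sum_{n\in q(\lambda)+\mathbb Z}a(\lambda,n)e(n\tau)\mathfrak e_\lambda$ has $a(\lambda,n)=0$ for all $n<0$, and let $\mathcal S_{L,k}$ be the subspace of cusp forms, where $a(\lambda,n)=0$ for all $n\le0$. Define, for functions $f:\mathbb H\to\mathbb C[L'/L]$ and $g:\mathbb H\to\mathbb C[M'/M]$, $$({\uparrow}f)_\mu=\begin{cases}f_{\bar\mu},&\mu\in L'/M,\\0,&\mu\in M'/M,\ \mu\notin L'/M,\end{cases}\qquad({\downarrow}g)_{\bar\mu}=\sum_{\nu\in L/M}g_{\mu+\nu},$$ where $\bar\mu$ is the image of $\mu\in L'/M$ in $L'/L$, and in the second formula $\mu\in L'/M$ is any lift of $\bar\mu\in L'/L$. Then: a) For every $k\in\frac12\mathbb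 Z$ these formulas define linear operators $\downarrow:\mathcal M_{M,k}\to\mathcal M_{L,k}$ and $\uparrow:\mathcal M_{L,k}\to\mathcal M_{M,k}$, and both map cusp forms to cusp forms. b) If $q$ is positive definite, the theta series $\Theta_L(\tau)=\sum_{\lambda\in L'/L}\sum_{x\in\lambda+L}e(\tau q(x))\,\mathfrak e_\lambda$ and $\Theta_M$ converge, and $\downarrow\Theta_M=\Theta_L$. c) With the Petersson product $\langle f_1,f_2\rangle_L=\int_{\mathrm{SL}_2(\mathbb Z)\backslash\mathbb H}\sum_\lambda f_{1,\lambda}(\tau)\overline{f_{2,\lambda}(\tau)}\,v^k\,\frac{du\,dv}{v^2}$ (where $\tau=u+iv$), for all $f\in\mathcal M_{L,k}$ and $g\in\mathcal M_{M,k}$ at least one of which is a cusp form, the integrals below converge and $$\langle f,{\downarrow}g\rangle_L=\langle{\uparrow}f,g\rangle_M.$$ d) The image $B$ of $\uparrow$ in $\mathcal M_{M,k}$ is the subspace of all $g\in\mathcal M_{M,k}$ supported on $L'/M$, i.e. with $g_\mu=0$ for $\mu\notin L'/M$. Moreover ${\downarrow}\circ{\uparrow}=|L/M|\cdot\mathrm{id}$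 on $\mathcal M_{L,k}$ and ${\uparrow}\circ{\downarrow}|_B=|L/M|\cdot\mathrm{id}_B$. -/

import Mathlib

open MeasureTheory
open scoped UpperHalfPlane MatrixGroups Manifold ComplexConjugate Real

noncomputable section

namespace VVMF

/-! ### Even lattices and their discriminant forms -/

/-- An even non-degenerate lattice in the rational quadratic space `(V, Q)`: a finitely generated
subgroup spanning `V` on which `Q` is integral, where the bilinear form
`β(x, y) = Q (x + y) - Q x - Q y` (so that `Q x = β(x, x) / 2`) is non-degenerate. -/
structure EvenLattice {V : Type*} [AddCommGroup V] [Module ℚ V] (Q : QuadraticForm ℚ V) where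
  carrier : Submodule ℤ V
  isLattice : carrier.IsLattice ℚ
  even : ∀ x ∈ carrier, ∃ n : ℤ, Q x = n
  nondegenerate : Q.polarBilin.Nondegenerate

section Lattice

variable {V : Type*} [AddCommGroup V] [Module ℚ V] {Q : QuadraticForm ℚ V}

/-- The dual lattice `L' = {x ∈ V | β(x, y) ∈ ℤ for all y ∈ L}`. -/
def EvenLattice.dual (L : EvenLattice Q) : Submodule ℤ V :=
  LinearMap.BilinForm.dualSubmodule Q.polarBilin L.carrier

theorem EvenLattice.mem_dual (L : EvenLattice Q) {x : V} :
    x ∈ L.dual ↔ ∀ y ∈ L.carrier, ∃ n : ℤ, QuadraticMap.polar Q x y = n := by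
  simp only [EvenLattice.dual, LinearMap.BilinForm.mem_dualSubmodule, Submodule.mem_one]
  constructor
  · intro h y hy
    obtain ⟨n, hn⟩ := h y hy
    exact ⟨n, by simpa using hn.symm⟩
  · intro h y hy
    obtain ⟨n, hn⟩ := h y hy
    exact ⟨n, by simpa using hn.symm⟩

theorem EvenLattice.le_dual (L : EvenLattice Q) : L.carrier ≤ L.dual := by
  intro x hx
  rw [L.mem_dual]
  intro y hy
  obtain ⟨a, ha⟩ := L.even _ (add_mem hx hy)
  obtain ⟨b, hb⟩ := L.even _ hx
  obtain ⟨c, hc⟩ := L.even _ hy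
  exact ⟨a - b - c, by simp [QuadraticMap.polar, ha, hb, hc]⟩

theorem EvenLattice.dual_anti {M L : EvenLattice Q} (h : M.carrier ≤ L.carrier) :
    L.dual ≤ M.dual := by
  intro x hx
  rw [EvenLattice.mem_dual] at hx ⊢
  exact fun y hy => hx y (h hy)

/-- The discriminant group `L' / L`. -/
abbrev EvenLattice.Disc (L : EvenLattice Q) : Type _ :=
  L.dual ⧸ L.carrier.submoduleOf L.dual

/-- The class in `L' / L` of an element of `L'`. -/
abbrev EvenLattice.cls (L : EvenLattice Q) (x : L.dual) : L.Disc := Submodule.Quotient.mk x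

theorem EvenLattice.exists_basis (L : EvenLattice Q) :
    ∃ (n : ℕ) (b : Module.Basis (Fin n) ℚ V),
      L.carrier = Submodule.span ℤ (Set.range b) := by
  have := L.isLattice
  let b₀ := Module.Free.chooseBasis ℤ L.carrier
  let b₁ := b₀.reindex (Fintype.equivFin _)
  refine ⟨_, b₁.extendOfIsLattice ℚ, ?_⟩
  have h := congrArg (Submodule.map L.carrier.subtype) b₁.span_eq
  rw [Submodule.map_span, Submodule.map_subtype_top, ← Set.range_comp] at h
  refine h.symm.trans (congrArg (fun s => Submodule.span ℤ (Set.range s)) ?_)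
  funext i
  simp [b₁, Module.Basis.extendOfIsLattice_apply]

theorem EvenLattice.polar_symm : LinearMap.BilinForm.IsSymm Q.polarBilin :=
  ⟨fun x y => by simp [QuadraticMap.polar_comm Q x y]⟩

/-- The bidual of a lattice is the lattice itself. -/
theorem EvenLattice.mem_of_bidual (L : EvenLattice Q) {x : V}
    (hx : ∀ y ∈ L.dual, ∃ n : ℤ, QuadraticMap.polar Q x y = n) : x ∈ L.carrier := by
  obtain ⟨n, b, hb⟩ := L.exists_basis
  have h := LinearMap.BilinForm.dualSubmodule_dualSubmodule_of_basis (R := ℤ) (S := ℚ) (M := V)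
    Q.polarBilin L.nondegenerate EvenLattice.polar_symm b
  rw [← hb] at h
  rw [← h, LinearMap.BilinForm.mem_dualSubmodule]
  intro y hy
  obtain ⟨k, hk⟩ := hx y hy
  exact Submodule.mem_one.mpr ⟨k, by simpa using hk.symm⟩

theorem EvenLattice.dual_fg (L : EvenLattice Q) : L.dual.FG := by
  obtain ⟨n, b, hb⟩ := L.exists_basis
  have h := LinearMap.BilinForm.dualSubmodule_span_of_basis (R := ℤ) (S := ℚ) (M := V)
    Q.polarBilin L.nondegenerate b
  rw [EvenLattice.dual, hb, h]
  exact Submodule.fg_span (Set.finite_range _)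

theorem EvenLattice.exists_smul_mem (L : EvenLattice Q) (x : V) :
    ∃ n : ℤ, n ≠ 0 ∧ n • x ∈ L.carrier := by
  have hx : x ∈ Submodule.span ℚ (L.carrier : Set V) := by
    rw [L.isLattice.span_eq_top]; trivial
  induction hx using Submodule.span_induction with
  | mem x h => exact ⟨1, one_ne_zero, by simpa using h⟩
  | zero => exact ⟨1, one_ne_zero, by simp⟩
  | add x y _ _ hx hy =>
    obtain ⟨a, ha, hax⟩ := hx
    obtain ⟨b, hb, hby⟩ := hy
    refine ⟨a * b, mul_ne_zero ha hb, ?_⟩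
    have h : (a * b) • (x + y) = b • a • x + a • b • y := by
      simp only [smul_add, smul_smul, mul_comm b a]
    rw [h]
    exact add_mem (L.carrier.smul_mem _ hax) (L.carrier.smul_mem _ hby)
  | smul q x _ hx =>
    obtain ⟨a, ha, hax⟩ := hx
    refine ⟨q.den * a, mul_ne_zero (by exact_mod_cast q.den_ne_zero) ha, ?_⟩
    have : ((q.den : ℤ) * a) • q • x = q.num • a • x := by
      simp only [← Int.cast_smul_eq_zsmul ℚ, smul_smul]
      congr 1
      push_cast
      have := Rat.den_mul_eq_num q
      linear_combination (a : ℚ) * this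
    rw [this]
    exact L.carrier.smul_mem _ hax

instance EvenLattice.finite_disc (L : EvenLattice Q) : Finite L.Disc := by
  have : Module.Finite ℤ L.dual := Module.Finite.iff_fg.mpr L.dual_fg
  refine Module.finite_of_fg_torsion _ ?_
  intro x
  induction x using Submodule.Quotient.induction_on with
  | _ x =>
  obtain ⟨n, hn, hx⟩ := L.exists_smul_mem (x : V)
  refine ⟨⟨n, mem_nonZeroDivisors_of_ne_zero hn⟩, ?_⟩
  change n • L.cls x = 0
  rw [← Submodule.Quotient.mk_smul, Submodule.Quotient.mk_eq_zero]
  exact hx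

instance EvenLattice.fintype_disc (L : EvenLattice Q) : Fintype L.Disc := Fintype.ofFinite _

/-- The quadratic form `q : L' / L → ℚ / ℤ` induced by `Q`. -/
def EvenLattice.qd (L : EvenLattice Q) (l : L.Disc) : AddCircle (1 : ℚ) :=
  Quotient.liftOn' l (fun x => ((Q (x : V) : ℚ) : AddCircle (1 : ℚ))) (by
    intro x y hxy
    have h : (x : V) - y ∈ L.carrier := by
      exact (Submodule.quotientRel_def (L.carrier.submoduleOf L.dual)).mp hxy
    obtain ⟨a, ha⟩ := L.even _ h
    obtain ⟨b, hb⟩ := L.mem_dual.mp y.2 _ h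
    have hQ : Q (x : V) = Q y + (a + b : ℤ) • (1 : ℚ) := by
      rw [QuadraticMap.polar, add_sub_cancel, ha] at hb
      push_cast [zsmul_eq_mul]
      linarith
    change ((Q (x : V) : ℚ) : AddCircle (1 : ℚ)) = ((Q (y : V) : ℚ) : AddCircle (1 : ℚ))
    rw [hQ, AddCircle.coe_add, AddCircle.coe_zsmul, AddCircle.coe_period, smul_zero, add_zero])

theorem EvenLattice.qd_cls (L : EvenLattice Q) (x : L.dual) :
    L.qd (L.cls x) = ((Q (x : V) : ℚ) : AddCircle (1 : ℚ)) := rfl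

/-- The bilinear form `β : L' / L × L' / L → ℚ / ℤ` attached to `q`. -/
def EvenLattice.bd (L : EvenLattice Q) (l m : L.Disc) : AddCircle (1 : ℚ) :=
  L.qd (l + m) - L.qd l - L.qd m

theorem EvenLattice.bd_cls (L : EvenLattice Q) (x y : L.dual) :
    L.bd (L.cls x) (L.cls y) =
      ((QuadraticMap.polar Q (x : V) (y : V) : ℚ) : AddCircle (1 : ℚ)) := by
  rw [EvenLattice.bd, ← Submodule.Quotient.mk_add]
  simp only [EvenLattice.qd_cls, QuadraticMap.polar, AddCircle.coe_sub, Submodule.coe_add]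

theorem EvenLattice.bd_comm (L : EvenLattice Q) (l m : L.Disc) : L.bd l m = L.bd m l := by
  simp only [EvenLattice.bd, add_comm l m]; abel

theorem EvenLattice.bd_add_right (L : EvenLattice Q) (l m n : L.Disc) :
    L.bd l (m + n) = L.bd l m + L.bd l n := by
  induction l using Submodule.Quotient.induction_on with
  | _ x =>
  induction m using Submodule.Quotient.induction_on with
  | _ y =>
  induction n using Submodule.Quotient.induction_on with
  | _ z =>
  rw [← Submodule.Quotient.mk_add]
  simp only [EvenLattice.bd_cls, Submodule.coe_add, QuadraticMap.polar_add_right, AddCircle.coe_add]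

theorem EvenLattice.bd_nondeg (L : EvenLattice Q) (l : L.Disc) (h : ∀ m, L.bd l m = 0) :
    l = 0 := by
  induction l using Submodule.Quotient.induction_on with
  | _ x =>
  rw [Submodule.Quotient.mk_eq_zero]
  refine L.mem_of_bidual fun y hy => ?_
  have := h (L.cls ⟨y, hy⟩)
  rw [EvenLattice.bd_cls, AddCircle.coe_eq_zero_iff] at this
  obtain ⟨n, hn⟩ := this
  exact ⟨n, by simpa using hn.symm⟩

/-- `e(x) = exp(2πix)` for `x ∈ ℚ / ℤ`. -/
def eQZ : AddCircle (1 : ℚ) → ℂ :=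
  Function.Periodic.lift (f := fun x : ℚ => Complex.exp (2 * π * Complex.I * x)) (c := 1) (by
    intro x
    change Complex.exp (2 * π * Complex.I * ((x + 1 : ℚ) : ℂ)) = Complex.exp (2 * π * Complex.I * x)
    push_cast
    rw [mul_add, Complex.exp_add, mul_one, Complex.exp_two_pi_mul_I, mul_one])

theorem eQZ_coe (x : ℚ) : eQZ (x : AddCircle (1 : ℚ)) = Complex.exp (2 * π * Complex.I * x) := rfl

theorem eQZ_zero : eQZ 0 = 1 := by
  have := eQZ_coe 0
  simpa using this

theorem eQZ_add (x y : AddCircle (1 : ℚ)) : eQZ (x + y) = eQZ x * eQZ y := by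
  induction x using QuotientAddGroup.induction_on with
  | _ x =>
  induction y using QuotientAddGroup.induction_on with
  | _ y =>
  rw [← QuotientAddGroup.mk_add]
  change eQZ ((x + y : ℚ) : AddCircle (1 : ℚ)) = _ * _
  change Complex.exp _ = Complex.exp _ * Complex.exp _
  rw [← Complex.exp_add]
  push_cast
  ring_nf

theorem eQZ_eq_one_iff (x : AddCircle (1 : ℚ)) : eQZ x = 1 ↔ x = 0 := by
  induction x using QuotientAddGroup.induction_on with
  | _ x =>
  change eQZ (x : AddCircle (1 : ℚ)) = 1 ↔ (x : AddCircle (1 : ℚ)) = 0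
  rw [eQZ_coe, Complex.exp_eq_one_iff, AddCircle.coe_eq_zero_iff]
  refine exists_congr fun n => ?_
  have h : (2 * π * Complex.I : ℂ) ≠ 0 := Complex.two_pi_I_ne_zero
  rw [mul_comm (n : ℂ), mul_right_inj' h]
  simp only [zsmul_eq_mul, mul_one]
  constructor
  · intro h; exact_mod_cast h.symm
  · intro h; exact_mod_cast h.symm

open scoped Classical in
theorem EvenLattice.sum_eQZ_bd (L : EvenLattice Q) (l : L.Disc) :
    ∑ m, eQZ (L.bd l m) = if l = 0 then (Fintype.card L.Disc : ℂ) else 0 := by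
  classical
  let ψ : AddChar L.Disc ℂ :=
    { toFun := fun m => eQZ (L.bd l m)
      map_zero_eq_one' := by
        have : L.bd l 0 = 0 := by
          have := L.bd_add_right l 0 0
          simpa using this
        rw [this, eQZ_zero]
      map_add_eq_mul' := fun m n => by rw [L.bd_add_right, eQZ_add] }
  have h := AddChar.sum_eq_ite ψ
  have hψ : ψ = 0 ↔ l = 0 := by
    constructor
    · intro h0
      refine L.bd_nondeg l fun m => ?_
      rw [← eQZ_eq_one_iff]
      exact DFunLike.congr_fun h0 m
    · rintro rfl
      ext m
      change eQZ (L.bd 0 m) = 1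
      have : L.bd 0 m = 0 := by
        rw [L.bd_comm]
        have := L.bd_add_right m 0 0
        simpa using this
      rw [this, eQZ_zero]
  simp only [hψ] at h
  exact h

/-! ### The Weil representation -/

/-- `ρ_L(T)`, acting on the group algebra `ℂ[L'/L]` (functions on `L' / L`, the basis vector `𝔢_λ`
being the indicator of `λ`): `𝔢_λ ↦ e(q(λ)) 𝔢_λ`. -/
def EvenLattice.weilT (L : EvenLattice Q) : (L.Disc → ℂ) ≃ₗ[ℂ] (L.Disc → ℂ) :=
  LinearEquiv.ofLinearMap
    (LinearMap.pi fun l => eQZ (L.qd l) • LinearMap.proj l)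
    (LinearMap.pi fun l => eQZ (-L.qd l) • LinearMap.proj l)
    (by
      refine LinearMap.ext fun v => funext fun l => ?_
      have h : eQZ (L.qd l) * eQZ (-L.qd l) = 1 := by rw [← eQZ_add, add_neg_cancel, eQZ_zero]
      simp [← mul_assoc, h])
    (by
      refine LinearMap.ext fun v => funext fun l => ?_
      have h : eQZ (-L.qd l) * eQZ (L.qd l) = 1 := by rw [← eQZ_add, neg_add_cancel, eQZ_zero]
      simp [← mul_assoc, h])

theorem EvenLattice.weilT_apply (L : EvenLattice Q) (v : L.Disc → ℂ) (l : L.Disc) :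
    L.weilT v l = eQZ (L.qd l) * v l := rfl

/-- The signature `b⁺ - b⁻` of the lattice. -/
def EvenLattice.sig (_L : EvenLattice Q) : ℤ := (sigPos Q : ℤ) - sigNeg Q

/-- The scalar `e(-sig / 8) / √|L'/L|`. -/
def EvenLattice.weilConst (L : EvenLattice Q) : ℂ :=
  Complex.exp (2 * π * Complex.I * (-(L.sig : ℂ) / 8)) / (√(Fintype.card L.Disc : ℝ) : ℝ)

theorem EvenLattice.weilConst_ne_zero (L : EvenLattice Q) : L.weilConst ≠ 0 := by
  refine div_ne_zero (Complex.exp_ne_zero _) ?_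
  have : (0 : ℝ) < Fintype.card L.Disc := by exact_mod_cast Fintype.card_pos
  exact_mod_cast (Real.sqrt_pos.mpr this).ne'

/-- The linear map `𝔢_λ ↦ ∑_μ e(s β(λ, μ)) 𝔢_μ` for an integer `s`. -/
def EvenLattice.dft (L : EvenLattice Q) (s : ℤ) : (L.Disc → ℂ) →ₗ[ℂ] (L.Disc → ℂ) :=
  LinearMap.pi fun m => ∑ l, eQZ (s • L.bd l m) • LinearMap.proj l

theorem EvenLattice.dft_apply (L : EvenLattice Q) (s : ℤ) (v : L.Disc → ℂ) (m : L.Disc) :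
    L.dft s v m = ∑ l, eQZ (s • L.bd l m) * v l := by
  simp [EvenLattice.dft]

theorem EvenLattice.bd_neg_left (L : EvenLattice Q) (l m : L.Disc) : L.bd (-l) m = -L.bd l m := by
  rw [L.bd_comm, L.bd_comm l, eq_neg_iff_add_eq_zero, ← L.bd_add_right, neg_add_cancel]
  have := L.bd_add_right m 0 0
  simpa using this

theorem EvenLattice.dft_dft_neg (L : EvenLattice Q) (s : ℤ) (hs : s = 1 ∨ s = -1)
    (v : L.Disc → ℂ) : L.dft s (L.dft (-s) v) = (Fintype.card L.Disc : ℂ) • v := by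
  classical
  funext n
  simp only [EvenLattice.dft_apply, Finset.mul_sum, ← mul_assoc, ← eQZ_add]
  rw [Finset.sum_comm]
  have h : ∀ l m : L.Disc, s • L.bd m n + -s • L.bd l m = L.bd (s • (n - l)) m := by
    intro l m
    have hsub : L.bd (n - l) m = L.bd m n - L.bd l m := by
      rw [L.bd_comm, sub_eq_add_neg, L.bd_add_right, L.bd_comm m (-l), L.bd_neg_left,
        sub_eq_add_neg]
    rcases hs with rfl | rfl
    · rw [one_smul, one_smul, hsub]
      simp [sub_eq_add_neg]
    · rw [show (-1 : ℤ) • (n - l) = -(n - l) by simp, L.bd_neg_left, hsub]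
      simp [add_comm, sub_eq_add_neg]
  simp only [h, ← Finset.sum_mul, L.sum_eQZ_bd]
  have h2 : ∀ l : L.Disc, s • (n - l) = 0 ↔ l = n := by
    intro l
    rcases hs with rfl | rfl
    · simp [sub_eq_zero, eq_comm]
    · rw [show (-1 : ℤ) • (n - l) = -(n - l) by simp, neg_eq_zero, sub_eq_zero, eq_comm]
  simp [h2]

/-- `ρ_L(S)`: `𝔢_λ ↦ e(-sig / 8) / √|L'/L| ∑_μ e(-β(λ, μ)) 𝔢_μ`. -/
def EvenLattice.weilS (L : EvenLattice Q) : (L.Disc → ℂ) ≃ₗ[ℂ] (L.Disc → ℂ) :=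
  LinearEquiv.ofLinearMap
    (L.weilConst • L.dft (-1))
    ((L.weilConst⁻¹ * (Fintype.card L.Disc : ℂ)⁻¹) • L.dft 1)
    (by
      refine LinearMap.ext fun v => ?_
      have hc := L.weilConst_ne_zero
      have hd : (Fintype.card L.Disc : ℂ) ≠ 0 := by exact_mod_cast Fintype.card_ne_zero
      have := L.dft_dft_neg (-1) (Or.inr rfl) v
      rw [neg_neg] at this
      simp only [LinearMap.comp_apply, LinearMap.smul_apply, map_smul, this, smul_smul,
        LinearMap.id_apply]
      refine (congrArg (· • v) (?_ : _ = (1 : ℂ))).trans (one_smul _ _)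
      field_simp)
    (by
      refine LinearMap.ext fun v => ?_
      have hc := L.weilConst_ne_zero
      have hd : (Fintype.card L.Disc : ℂ) ≠ 0 := by exact_mod_cast Fintype.card_ne_zero
      have := L.dft_dft_neg 1 (Or.inl rfl) v
      simp only [LinearMap.comp_apply, LinearMap.smul_apply, map_smul, this, smul_smul,
        LinearMap.id_apply]
      refine (congrArg (· • v) (?_ : _ = (1 : ℂ))).trans (one_smul _ _)
      field_simp)

theorem EvenLattice.weilS_apply (L : EvenLattice Q) (v : L.Disc → ℂ) (m : L.Disc) :
    L.weilS v m = L.weilConst * ∑ l, eQZ (-L.bd l m) * v l := by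
  change L.weilConst * L.dft (-1) v m = _
  simp [EvenLattice.dft_apply]


/-! ### The metaplectic group -/

/-- The metaplectic group `Mp₂(ℤ)`: pairs of `γ = (a b; c d) ∈ SL₂(ℤ)` and a holomorphic square
root `φ` of `τ ↦ cτ + d` on the upper half-plane. -/
@[ext]
structure MpTwoZ where
  mat : SL(2, ℤ)
  root : ℍ → ℂ
  holo : MDifferentiable 𝓘(ℂ) 𝓘(ℂ) root
  sq : ∀ τ : ℍ, root τ ^ 2 = ((mat 1 0 : ℤ) : ℂ) * τ + ((mat 1 1 : ℤ) : ℂ)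

theorem denom_sl (g : SL(2, ℤ)) (τ : ℍ) :
    UpperHalfPlane.denom g τ = ((g 1 0 : ℤ) : ℂ) * τ + ((g 1 1 : ℤ) : ℂ) := by
  simp [UpperHalfPlane.denom]

theorem MpTwoZ.sq' (γ : MpTwoZ) (τ : ℍ) : γ.root τ ^ 2 = UpperHalfPlane.denom γ.mat τ := by
  rw [γ.sq, denom_sl]

theorem MpTwoZ.root_ne_zero (γ : MpTwoZ) (τ : ℍ) : γ.root τ ≠ 0 := by
  intro h
  have := γ.sq' τ
  rw [h, zero_pow two_ne_zero] at this
  exact UpperHalfPlane.denom_ne_zero _ _ this.symm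

theorem mdiff_sl_smul (g : SL(2, ℤ)) :
    MDifferentiable 𝓘(ℂ) 𝓘(ℂ) (fun τ : ℍ => g • τ) := by
  have h := UpperHalfPlane.mdifferentiable_smul (g := (g : GL (Fin 2) ℝ)) (by simp)
  exact h

theorem denom_sl_mul (g h : SL(2, ℤ)) (τ : ℍ) :
    UpperHalfPlane.denom ((g * h : SL(2, ℤ)) : GL (Fin 2) ℝ) τ =
      UpperHalfPlane.denom g ((h • τ : ℍ) : ℂ) * UpperHalfPlane.denom h τ := by
  have h1 := UpperHalfPlane.denom_cocycle_σ (g : GL (Fin 2) ℝ) (h : GL (Fin 2) ℝ) τ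
  rw [map_mul, map_mul, h1]
  simp [UpperHalfPlane.σ]

/-- The group law `(γ, φ) (γ', φ') = (γγ', φ(γ'τ) φ'(τ))`. -/
instance : Mul MpTwoZ where
  mul g h :=
    { mat := g.mat * h.mat
      root := fun τ => g.root (h.mat • τ) * h.root τ
      holo := (g.holo.comp (mdiff_sl_smul h.mat)).mul h.holo
      sq := fun τ => by
        rw [mul_pow, g.sq', h.sq', ← denom_sl_mul, denom_sl] }

instance : One MpTwoZ where
  one :=
    { mat := 1
      root := fun _ => 1
      holo := mdifferentiable_const
      sq := fun τ => by simp }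

instance : Inv MpTwoZ where
  inv g :=
    { mat := g.mat⁻¹
      root := fun τ => (g.root (g.mat⁻¹ • τ))⁻¹
      holo := by
        have h : MDifferentiable 𝓘(ℂ) 𝓘(ℂ) (fun τ : ℍ => g.root (g.mat⁻¹ • τ)) :=
          g.holo.comp (mdiff_sl_smul g.mat⁻¹)
        rw [UpperHalfPlane.mdifferentiable_iff] at h ⊢
        exact h.inv fun z _ => g.root_ne_zero _
      sq := fun τ => by
        rw [inv_pow, g.sq', ← denom_sl]
        refine inv_eq_of_mul_eq_one_right ?_
        rw [← denom_sl_mul, mul_inv_cancel, denom_sl]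
        simp }

theorem MpTwoZ.mul_mat (g h : MpTwoZ) : (g * h).mat = g.mat * h.mat := rfl

theorem MpTwoZ.mul_root (g h : MpTwoZ) (τ : ℍ) :
    (g * h).root τ = g.root (h.mat • τ) * h.root τ := rfl

theorem MpTwoZ.one_mat : (1 : MpTwoZ).mat = 1 := rfl

theorem MpTwoZ.one_root (τ : ℍ) : (1 : MpTwoZ).root τ = 1 := rfl

instance : Group MpTwoZ :=
  Group.ofLeftAxioms
    (fun a b c => MpTwoZ.ext (mul_assoc _ _ _) (funext fun τ => by
      simp only [MpTwoZ.mul_root, MpTwoZ.mul_mat, mul_smul, mul_assoc]))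
    (fun a => MpTwoZ.ext (one_mul _) (funext fun τ => by
      simp only [MpTwoZ.mul_root, MpTwoZ.one_root, one_mul]))
    (fun a => MpTwoZ.ext (inv_mul_cancel _) (funext fun τ => by
      change (a.root (a.mat⁻¹ • a.mat • τ))⁻¹ * a.root τ = 1
      rw [inv_smul_smul, inv_mul_cancel₀ (a.root_ne_zero τ)]))

/-- The generator `T = ((1 1; 0 1), 1)`. -/
def MpTwoZ.T : MpTwoZ where
  mat := ModularGroup.T
  root := fun _ => 1
  holo := mdifferentiable_const
  sq := fun τ => by simp [ModularGroup.T]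

/-- The generator `S = ((0 -1; 1 0), √τ)`, with the principal branch of the square root. -/
def MpTwoZ.S : MpTwoZ where
  mat := ModularGroup.S
  root := fun τ => (τ : ℂ) ^ (1 / 2 : ℂ)
  holo := by
    rw [UpperHalfPlane.mdifferentiable_iff]
    have h : DifferentiableOn ℂ (fun z : ℂ => z ^ (1 / 2 : ℂ)) {z | 0 < z.im} := fun z hz =>
      (differentiableAt_id.cpow_const (Or.inr (ne_of_gt hz))).differentiableWithinAt
    refine h.congr fun z hz => ?_
    simp [UpperHalfPlane.ofComplex_apply_of_im_pos hz]
  sq := fun τ => by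
    rw [← Complex.cpow_nat_mul]
    simp [ModularGroup.S]

/-- `Mp₂(ℤ)` is generated by `S` and `T`. -/
theorem MpTwoZ.closure_eq_top : Subgroup.closure {MpTwoZ.T, MpTwoZ.S} = ⊤ := by
  let pr : MpTwoZ →* SL(2, ℤ) := ⟨⟨MpTwoZ.mat, rfl⟩, fun _ _ => rfl⟩
  have hT : MpTwoZ.T ∈ Subgroup.closure {MpTwoZ.T, MpTwoZ.S} :=
    Subgroup.subset_closure (Or.inl rfl)
  have hS : MpTwoZ.S ∈ Subgroup.closure {MpTwoZ.T, MpTwoZ.S} :=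
    Subgroup.subset_closure (Or.inr rfl)
  have hsurj : (Subgroup.closure {MpTwoZ.T, MpTwoZ.S}).map pr = ⊤ := by
    rw [eq_top_iff, ← SpecialLinearGroup.SL2Z_generators, Subgroup.closure_le]
    rintro _ (rfl | rfl)
    · exact ⟨MpTwoZ.S, hS, rfl⟩
    · exact ⟨MpTwoZ.T, hT, rfl⟩
  rw [eq_top_iff]
  intro g _
  obtain ⟨h, hh, hhg⟩ : g.mat ∈ (Subgroup.closure {MpTwoZ.T, MpTwoZ.S}).map pr := by
    rw [hsurj]; trivial
  have hk : (g * h⁻¹).mat = 1 := by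
    change g.mat * h.mat⁻¹ = 1
    rw [← hhg]
    exact mul_inv_cancel _
  suffices hgh : g * h⁻¹ ∈ Subgroup.closure {MpTwoZ.T, MpTwoZ.S} by
    simpa using mul_mem hgh hh
  generalize g * h⁻¹ = k at hk
  have hsq : ∀ τ, k.root τ ^ 2 = 1 := fun τ => by rw [k.sq, hk]; simp
  have hconst : k.root = (fun _ => 1) ∨ k.root = (fun _ => -1) := by
    have hc : Continuous k.root := k.holo.continuous
    have hs := isPreconnected_univ (α := ℍ) |>.eq_one_or_eq_neg_one_of_sq_eq hc.continuousOn
      (fun τ _ => hsq τ)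
    exact hs.imp (fun h => funext fun τ => h (Set.mem_univ τ))
      (fun h => funext fun τ => h (Set.mem_univ τ))
  rcases hconst with h1 | h1
  · have : k = 1 := MpTwoZ.ext hk h1
    rw [this]; exact one_mem _
  · have : k = MpTwoZ.S ^ 4 := by
      refine MpTwoZ.ext ?_ ?_
      · rw [hk]
        change 1 = pr (MpTwoZ.S ^ 4)
        rw [map_pow]
        change 1 = ModularGroup.S ^ 4
        decide
      · have hS2 : ∀ τ : ℍ, MpTwoZ.S.root τ ^ 2 = τ := fun τ => by
          rw [MpTwoZ.S.sq]; simp [MpTwoZ.S, ModularGroup.S]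
        have h2 : ∀ τ : ℍ, ModularGroup.S • ModularGroup.S • τ = τ := fun τ => by
          rw [← mul_smul, show ModularGroup.S * ModularGroup.S = -1 by decide,
            ModularGroup.SL_neg_smul, one_smul]
        rw [h1]
        funext τ
        have h4 : (MpTwoZ.S ^ 4).root τ =
            MpTwoZ.S.root (ModularGroup.S • τ) ^ 2 * MpTwoZ.S.root τ ^ 2 := by
          have : MpTwoZ.S ^ 4 = MpTwoZ.S * (MpTwoZ.S * (MpTwoZ.S * MpTwoZ.S)) := by
            simp only [pow_succ, pow_zero, one_mul, mul_assoc]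
          rw [this]
          simp only [MpTwoZ.mul_root, MpTwoZ.mul_mat, mul_smul]
          change MpTwoZ.S.root (ModularGroup.S • ModularGroup.S • ModularGroup.S • τ) *
            (MpTwoZ.S.root (ModularGroup.S • ModularGroup.S • τ) *
              (MpTwoZ.S.root (ModularGroup.S • τ) * MpTwoZ.S.root τ)) = _
          rw [h2, h2]
          ring
        rw [h4, hS2, hS2, UpperHalfPlane.modular_S_smul]
        have := τ.ne_zero
        change -1 = (-(τ : ℂ))⁻¹ * τ
        field_simp
    rw [this]; exact pow_mem hS 4

/-- The graph of the Weil representation `ρ_L : Mp₂(ℤ) → GL(ℂ[L'/L])`, i.e. the set of all pairs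
`(γ, ρ_L(γ))`. As `ρ_L` is the homomorphism determined by its values on the generators `T` and `S`,
its graph is the subgroup generated by `(T, ρ_L(T))` and `(S, ρ_L(S))`. -/
def EvenLattice.weilGraph (L : EvenLattice Q) :
    Subgroup (MpTwoZ × ((L.Disc → ℂ) ≃ₗ[ℂ] (L.Disc → ℂ))) :=
  Subgroup.closure {(MpTwoZ.T, L.weilT), (MpTwoZ.S, L.weilS)}

theorem EvenLattice.exists_mem_weilGraph (L : EvenLattice Q) (γ : MpTwoZ) :
    ∃ A, (γ, A) ∈ L.weilGraph := by
  have h : L.weilGraph.map (MonoidHom.fst _ _) = ⊤ := by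
    rw [EvenLattice.weilGraph, MonoidHom.map_closure, Set.image_pair]
    exact MpTwoZ.closure_eq_top
  have hγ : γ ∈ L.weilGraph.map (MonoidHom.fst _ _) := by rw [h]; trivial
  obtain ⟨⟨_, A⟩, hA, rfl⟩ := hγ
  exact ⟨A, hA⟩

/-! ### Vector-valued modular forms

The weight is `k = κ / 2` with `κ ∈ ℤ`. -/

/-- `f : ℍ → ℂ[L'/L]` is a modular function of weight `κ / 2`: for all `γ = (M, φ) ∈ Mp₂(ℤ)`,
`f(γτ) = φ(τ)^κ ρ_L(γ) f(τ)`. -/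
def IsModularFunction (L : EvenLattice Q) (κ : ℤ) (f : ℍ → L.Disc → ℂ) : Prop :=
  ∀ (γ : MpTwoZ) (A : (L.Disc → ℂ) ≃ₗ[ℂ] (L.Disc → ℂ)), (γ, A) ∈ L.weilGraph →
    ∀ τ : ℍ, f (γ.mat • τ) = γ.root τ ^ κ • A (f τ)

/-- `f` has the Fourier expansion `f(τ) = ∑_{λ ∈ L'/L} ∑_{n ∈ q(λ) + ℤ} a(λ, n) e(nτ) 𝔢_λ`. -/
def HasFourierExpansion (L : EvenLattice Q) (f : ℍ → L.Disc → ℂ) (a : L.Disc → ℚ → ℂ) : Prop :=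
  (∀ l n, a l n ≠ 0 → (n : AddCircle (1 : ℚ)) = L.qd l) ∧
    ∀ (τ : ℍ) (l : L.Disc), HasSum (fun n : ℚ => a l n * Complex.exp (2 * π * Complex.I * n * τ)) (f τ l)

/-- The common part of the definitions of modular and cusp forms: a holomorphic modular function
of weight `κ / 2` whose Fourier coefficients `a(λ, n)` vanish unless `p n`. -/
def formsSubmodule (L : EvenLattice Q) (κ : ℤ) (p : ℚ → Prop) :
    Submodule ℂ (ℍ → L.Disc → ℂ) where
  carrier := {f | IsModularFunction L κ f ∧
    (∀ l, MDifferentiable 𝓘(ℂ) 𝓘(ℂ) (fun τ : ℍ => f τ l)) ∧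
    ∃ a, HasFourierExpansion L f a ∧ ∀ l n, ¬ p n → a l n = 0}
  zero_mem' := by
    refine ⟨fun γ A _ τ => by simp, fun l => mdifferentiable_const, fun _ _ => 0,
      ⟨fun l n h => absurd rfl h, fun τ l => ?_⟩, fun _ _ _ => rfl⟩
    simp [hasSum_zero]
  add_mem' := by
    rintro f g ⟨hf, hf', a, ⟨ha, ha'⟩, hpa⟩ ⟨hg, hg', b, ⟨hb, hb'⟩, hpb⟩
    refine ⟨fun γ A hA τ => ?_, fun l => (hf' l).add (hg' l), fun l n => a l n + b l n,
      ⟨fun l n h => ?_, fun τ l => ?_⟩, fun l n h => by simp [hpa l n h, hpb l n h]⟩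
    · simp only [Pi.add_apply, hf γ A hA, hg γ A hA, map_add, smul_add]
    · by_cases h0 : a l n = 0
      · exact hb l n fun h1 => h (by simp [h0, h1])
      · exact ha l n h0
    · simpa only [add_mul] using! (ha' τ l).add (hb' τ l)
  smul_mem' := by
    rintro c f ⟨hf, hf', a, ⟨ha, ha'⟩, hpa⟩
    refine ⟨fun γ A hA τ => ?_, fun l => ?_, fun l n => c * a l n,
      ⟨fun l n h => ha l n fun h0 => h (by simp [h0]), fun τ l => ?_⟩,
      fun l n h => by simp [hpa l n h]⟩
    · simp only [Pi.smul_apply, hf γ A hA, map_smul]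
      rw [smul_comm]
    · exact mdifferentiable_const.mul (hf' l)
    · simpa only [mul_assoc] using! (ha' τ l).mul_left c

/-- The space `M_{L, κ/2}` of modular forms: holomorphic modular functions with `a(λ, n) = 0` for
all `n < 0`. -/
def modularForms (L : EvenLattice Q) (κ : ℤ) : Submodule ℂ (ℍ → L.Disc → ℂ) :=
  formsSubmodule L κ (fun n => 0 ≤ n)

/-- The space `S_{L, κ/2}` of cusp forms: holomorphic modular functions with `a(λ, n) = 0` for
all `n ≤ 0`. -/
def cuspForms (L : EvenLattice Q) (κ : ℤ) : Submodule ℂ (ℍ → L.Disc → ℂ) :=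
  formsSubmodule L κ (fun n => 0 < n)

/-- The integrand `∑_λ f_λ(τ) conj(g_λ(τ)) v^{κ/2}` (`v = Im τ`) of the Petersson product. -/
def peterssonIntegrand (L : EvenLattice Q) (κ : ℤ) (f g : ℍ → L.Disc → ℂ) (τ : ℍ) : ℂ :=
  (∑ l, f τ l * conj (g τ l)) * ((τ.im ^ ((κ : ℝ) / 2) : ℝ) : ℂ)

/-- The Petersson product `⟨f, g⟩_L`, the integral over the standard fundamental domain of `SL₂(ℤ)`
with respect to the invariant measure `du dv / v²`, which is Mathlib's `volume` on `ℍ`. -/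
def petersson (L : EvenLattice Q) (κ : ℤ) (f g : ℍ → L.Disc → ℂ) : ℂ :=
  ∫ τ in ModularGroup.fd, peterssonIntegrand L κ f g τ

/-- The summand `e(τ Q(x))` of the theta functions. -/
def thetaTerm (Q : QuadraticForm ℚ V) (τ : ℍ) (x : V) : ℂ :=
  Complex.exp (2 * π * Complex.I * τ * (Q x : ℚ))

/-- The theta function `Θ_L = ∑_λ θ_{L,λ} 𝔢_λ`, `θ_{L,λ}(τ) = ∑_{x ∈ L + λ} e(τ Q(x))`. -/
def Theta (L : EvenLattice Q) (τ : ℍ) (l : L.Disc) : ℂ :=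
  ∑' x : {x : L.dual // L.cls x = l}, thetaTerm Q τ (x : L.dual)

/-! ### The arrow operators for a sublattice `M ≤ L` -/

variable {M L : EvenLattice Q}

/-- The inclusion `L' / M → M' / M`. -/
def inclDual (h : M.carrier ≤ L.carrier) :
    (L.dual ⧸ M.carrier.submoduleOf L.dual) →ₗ[ℤ] M.Disc :=
  Submodule.mapQ _ _ (Submodule.inclusion (EvenLattice.dual_anti h)) (fun _ hx => hx)

/-- The projection `L' / M → L' / L`. -/
def projDual (h : M.carrier ≤ L.carrier) :
    (L.dual ⧸ M.carrier.submoduleOf L.dual) →ₗ[ℤ] L.Disc :=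
  Submodule.mapQ _ _ LinearMap.id (fun _ hx => h hx)

/-- The inclusion `L / M → L' / M`. -/
def inclLattice (M L : EvenLattice Q) :
    (L.carrier ⧸ M.carrier.submoduleOf L.carrier) →ₗ[ℤ]
      (L.dual ⧸ M.carrier.submoduleOf L.dual) :=
  Submodule.mapQ _ _ (Submodule.inclusion L.le_dual) (fun _ hx => hx)

theorem inclDual_injective (h : M.carrier ≤ L.carrier) : Function.Injective (inclDual h) := by
  rw [← LinearMap.ker_eq_bot, eq_bot_iff]
  intro x hx
  induction x using Submodule.Quotient.induction_on with
  | _ x =>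
  have hx' : (Submodule.Quotient.mk (Submodule.inclusion (EvenLattice.dual_anti h) x) : M.Disc) = 0
    := hx
  rw [Submodule.Quotient.mk_eq_zero] at hx'
  exact (Submodule.Quotient.mk_eq_zero _).mpr hx'

theorem inclLattice_injective (M L : EvenLattice Q) : Function.Injective (inclLattice M L) := by
  rw [← LinearMap.ker_eq_bot, eq_bot_iff]
  intro x hx
  induction x using Submodule.Quotient.induction_on with
  | _ x =>
  have hx' : (Submodule.Quotient.mk (Submodule.inclusion L.le_dual x) :
    L.dual ⧸ M.carrier.submoduleOf L.dual) = 0 := hx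
  rw [Submodule.Quotient.mk_eq_zero] at hx'
  exact (Submodule.Quotient.mk_eq_zero _).mpr hx'

theorem finite_lattice_quotient (h : M.carrier ≤ L.carrier) :
    Finite (L.carrier ⧸ M.carrier.submoduleOf L.carrier) :=
  Finite.of_injective _ ((inclDual_injective h).comp (inclLattice_injective M L))

theorem projDual_surjective (h : M.carrier ≤ L.carrier) : Function.Surjective (projDual h) := by
  intro l
  induction l using Submodule.Quotient.induction_on with
  | _ x => exact ⟨Submodule.Quotient.mk x, rfl⟩

open scoped Classical in
/-- The operator `↑` on `ℂ[L'/L]`: `(↑v)_μ` is `v_{μ̄}` if `μ ∈ L'/M`, with `μ̄` the image of `μ` in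
`L'/L`, and `0` otherwise. -/
def upCoeff (h : M.carrier ≤ L.carrier) : (L.Disc → ℂ) →ₗ[ℂ] (M.Disc → ℂ) :=
  LinearMap.pi fun m =>
    if hm : ∃ y, inclDual h y = m then LinearMap.proj (projDual h hm.choose) else 0

theorem upCoeff_apply (h : M.carrier ≤ L.carrier) (v : L.Disc → ℂ)
    (y : L.dual ⧸ M.carrier.submoduleOf L.dual) :
    upCoeff h v (inclDual h y) = v (projDual h y) := by
  have hm : ∃ y', inclDual h y' = inclDual h y := ⟨y, rfl⟩
  have hc : hm.choose = y := inclDual_injective h hm.choose_spec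
  simp only [upCoeff, LinearMap.pi_apply, dif_pos hm]
  rw [hc]
  rfl

theorem upCoeff_apply_of_notMem (h : M.carrier ≤ L.carrier) (v : L.Disc → ℂ) (m : M.Disc)
    (hm : m ∉ Set.range (inclDual h)) : upCoeff h v m = 0 := by
  have hm' : ¬ ∃ y, inclDual h y = m := hm
  simp only [upCoeff, LinearMap.pi_apply, dif_neg hm']
  rfl

/-- The operator `↓` on `ℂ[M'/M]`: `(↓w)_{μ̄} = ∑_{ν ∈ L/M} w_{μ + ν}` for `μ̄ ∈ L'/L`, where
`μ` is a lift of `μ̄` to `L'/M ⊆ M'/M`. -/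
def downCoeff (h : M.carrier ≤ L.carrier) : (M.Disc → ℂ) →ₗ[ℂ] (L.Disc → ℂ) :=
  have := finite_lattice_quotient h
  have := Fintype.ofFinite (L.carrier ⧸ M.carrier.submoduleOf L.carrier)
  LinearMap.pi fun l =>
    ∑ ν : L.carrier ⧸ M.carrier.submoduleOf L.carrier,
      LinearMap.proj (inclDual h ((projDual_surjective h l).choose + inclLattice M L ν))

/-- The value of `↓w` does not depend on the choice of the lift. -/
theorem downCoeff_apply (h : M.carrier ≤ L.carrier)
    [Fintype (L.carrier ⧸ M.carrier.submoduleOf L.carrier)] (w : M.Disc → ℂ)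
    (y : L.dual ⧸ M.carrier.submoduleOf L.dual) :
    downCoeff h w (projDual h y) =
      ∑ ν : L.carrier ⧸ M.carrier.submoduleOf L.carrier,
        w (inclDual h y + inclDual h (inclLattice M L ν)) := by
  obtain ⟨ν₀, hν₀⟩ : ∃ ν₀, (projDual_surjective h (projDual h y)).choose =
      y + inclLattice M L ν₀ := by
    have hc := (projDual_surjective h (projDual h y)).choose_spec
    generalize (projDual_surjective h (projDual h y)).choose = c at hc
    induction c using Submodule.Quotient.induction_on with
    | _ c =>
    induction y using Submodule.Quotient.induction_on with
    | _ y =>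
    have hc' : (Submodule.Quotient.mk c : L.Disc) = Submodule.Quotient.mk y := hc
    rw [Submodule.Quotient.eq] at hc'
    refine ⟨Submodule.Quotient.mk ⟨(c : V) - y, hc'⟩, ?_⟩
    change _ = Submodule.Quotient.mk y + Submodule.Quotient.mk _
    rw [← Submodule.Quotient.mk_add]
    congr 1
    ext
    simp
  rw [← Equiv.sum_comp (Equiv.addLeft ν₀)]
  simp only [downCoeff, LinearMap.pi_apply, hν₀, LinearMap.sum_apply, LinearMap.proj_apply,
    Equiv.coe_addLeft, map_add, add_assoc]
  congr!

/-- The operator `↑` on functions `ℍ → ℂ[L'/L]`. -/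
def upOp (h : M.carrier ≤ L.carrier) : (ℍ → L.Disc → ℂ) →ₗ[ℂ] (ℍ → M.Disc → ℂ) :=
  (upCoeff h).compLeft ℍ

/-- The operator `↓` on functions `ℍ → ℂ[M'/M]`. -/
def downOp (h : M.carrier ≤ L.carrier) : (ℍ → M.Disc → ℂ) →ₗ[ℂ] (ℍ → L.Disc → ℂ) :=
  (downCoeff h).compLeft ℍ

end Lattice
end VVMF

end

noncomputable section

namespace VVMF

section Arrows

variable {V : Type*} [AddCommGroup V] [Module ℚ V] {Q : QuadraticForm ℚ V}

/-! ### Discriminant forms of a lattice and a sublattice -/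

/-! Everything reduces to linear algebra on the finite groups L/M ⊆ L'/M ⊆ M'/M. The projection L'/M
→ L'/L preserves q and has kernel L/M, and L'/M is the orthogonal complement of L/M in M'/M.

Preservation of q makes ↑ commute with ρ(T). For ρ(S), the sum of the character e(β(m, ·)) over L/M
is |L/M| if m lies in L'/M and zero otherwise. The factor |L/M| is exactly the quotient of the two
normalising constants, because |M'/M| = |L/M|² |L'/L| and the signature depends only on Q
(`upCoeff_weilS`). The operator ↓ is the transpose of ↑ (`sum_downCoeff_mul`) and the matrices of
ρ(S) and ρ(T) are symmetric, so ↓ commutes with them too. A constant matrix commuting with both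
generators preserves the transformation law, acts on Fourier coefficients exponent by exponent, and
thus preserves modular and cusp forms (`map_mem_formsSubmodule`).

The matrix of ↓ is real, so the same transposition identifies the two Petersson integrands
pointwise. Convergence follows from the exponential decay of a cusp form and the finite volume of
the fundamental domain.

For the image of ↑, note that ρ_M(S) is a Fourier transform, which turns support on L'/M into
invariance under L/M. A modular form supported on L'/M is therefore also L/M-invariant, so ↑↓
multiplies it by |L/M|. For theta series, a coset of L splits into cosets of M. The rearrangement is
justified by absolute convergence, obtained by diagonalising Q over ℚ and comparing with a product
of Gaussian sums. -/

theorem eQZ_injective : Function.Injective eQZ := by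
  intro x y hxy
  have h : eQZ (x - y) * eQZ y = eQZ y := by rw [← eQZ_add, sub_add_cancel, hxy]
  have hy : eQZ y ≠ 0 := by
    intro h0
    have := eQZ_add y (-y)
    rw [add_neg_cancel, eQZ_zero, h0, zero_mul] at this
    exact one_ne_zero this
  rw [← sub_eq_zero, ← eQZ_eq_one_iff]
  exact mul_right_cancel₀ hy (h.trans (one_mul _).symm)

theorem EvenLattice.bd_add_left (L : EvenLattice Q) (l m n : L.Disc) :
    L.bd (l + m) n = L.bd l n + L.bd m n := by
  rw [L.bd_comm, L.bd_add_right, L.bd_comm n l, L.bd_comm n m]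

theorem EvenLattice.bd_zero_left (L : EvenLattice Q) (m : L.Disc) : L.bd 0 m = 0 := by
  simpa using L.bd_add_left 0 0 m

/-- Isolates the phase, which depends on Q alone and so is shared by M and L. -/
theorem EvenLattice.weilConst_mul_sqrt (L : EvenLattice Q) :
    L.weilConst * (√(Fintype.card L.Disc : ℝ) : ℝ) =
      Complex.exp (2 * π * Complex.I * (-(L.sig : ℂ) / 8)) := by
  have h : (0 : ℝ) < Fintype.card L.Disc := by exact_mod_cast Fintype.card_pos
  have h' : ((√(Fintype.card L.Disc : ℝ) : ℝ) : ℂ) ≠ 0 := by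
    exact_mod_cast (Real.sqrt_pos.mpr h).ne'
  rw [EvenLattice.weilConst, div_mul_cancel₀ _ h']

variable {M L : EvenLattice Q} (h : M.carrier ≤ L.carrier)

theorem finite_dual_quotient (h : M.carrier ≤ L.carrier) :
    Finite (L.dual ⧸ M.carrier.submoduleOf L.dual) :=
  Finite.of_injective _ (inclDual_injective h)

/-- Both sides are the class of `Q x` for one representative x in L'. -/
theorem qd_inclDual (y : L.dual ⧸ M.carrier.submoduleOf L.dual) :
    M.qd (inclDual h y) = L.qd (projDual h y) := by
  induction y using Submodule.Quotient.induction_on with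
  | _ y => rfl

theorem bd_inclDual (y z : L.dual ⧸ M.carrier.submoduleOf L.dual) :
    M.bd (inclDual h y) (inclDual h z) = L.bd (projDual h y) (projDual h z) := by
  simp only [EvenLattice.bd, ← map_add, qd_inclDual]

theorem projDual_inclLattice (ν : L.carrier ⧸ M.carrier.submoduleOf L.carrier) :
    projDual h (inclLattice M L ν) = 0 := by
  induction ν using Submodule.Quotient.induction_on with
  | _ x => exact (Submodule.Quotient.mk_eq_zero _).mpr x.2

/-- Together with `projDual_inclLattice`, exactness of L/M → L'/M → L'/L. -/
theorem exists_inclLattice_of_projDual_eq_zero {y : L.dual ⧸ M.carrier.submoduleOf L.dual}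
    (hy : projDual h y = 0) : ∃ ν, inclLattice M L ν = y := by
  induction y using Submodule.Quotient.induction_on with
  | _ y =>
  have hy' : y ∈ L.carrier.submoduleOf L.dual := (Submodule.Quotient.mk_eq_zero _).mp hy
  exact ⟨Submodule.Quotient.mk ⟨(y : V), hy'⟩, rfl⟩

/-- `L'/M` is the orthogonal complement of `L/M` in `M'/M`. -/
theorem mem_range_inclDual_iff (m : M.Disc) : m ∈ Set.range (inclDual h) ↔
    ∀ ν, M.bd m (inclDual h (inclLattice M L ν)) = 0 := by
  constructor
  · rintro ⟨y, rfl⟩ ν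
    rw [bd_inclDual, projDual_inclLattice, L.bd_comm, L.bd_zero_left]
  · intro hm
    induction m using Submodule.Quotient.induction_on with
    | _ x =>
    have hx : (x : V) ∈ L.dual := by
      rw [L.mem_dual]
      intro y hy
      have := hm (Submodule.Quotient.mk ⟨y, hy⟩)
      change M.bd (M.cls x) (M.cls ⟨y, _⟩) = 0 at this
      rw [EvenLattice.bd_cls, AddCircle.coe_eq_zero_iff] at this
      obtain ⟨n, hn⟩ := this
      exact ⟨n, by simpa using hn.symm⟩
    exact ⟨Submodule.Quotient.mk ⟨x, hx⟩, rfl⟩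

theorem projDual_surjInv (l : L.Disc) :
    projDual h (Function.surjInv (projDual_surjective h) l) = l :=
  Function.surjInv_eq (projDual_surjective h) l

/-- A set-theoretic splitting of `L'/M → L'/L` identifies `L'/M` with `L'/L × L/M`. -/
def splitDual : L.Disc × (L.carrier ⧸ M.carrier.submoduleOf L.carrier) ≃
    (L.dual ⧸ M.carrier.submoduleOf L.dual) :=
  Equiv.ofBijective
    (fun p => Function.surjInv (projDual_surjective h) p.1 + inclLattice M L p.2) (by
      constructor
      · rintro ⟨l, ν⟩ ⟨l', ν'⟩ hp
        have hl : l = l' := by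
          have := congrArg (projDual h) hp
          simpa only [map_add, projDual_inclLattice, add_zero, projDual_surjInv] using this
        subst hl
        exact Prod.ext rfl (inclLattice_injective M L (add_left_cancel hp))
      · intro y
        obtain ⟨ν, hν⟩ := exists_inclLattice_of_projDual_eq_zero h
          (y := y - Function.surjInv (projDual_surjective h) (projDual h y))
          (by rw [map_sub, projDual_surjInv, sub_self])
        exact ⟨(projDual h y, ν), by simp only [hν, add_sub_cancel]⟩)

theorem splitDual_apply (l : L.Disc) (ν : L.carrier ⧸ M.carrier.submoduleOf L.carrier) :
    splitDual h (l, ν) = Function.surjInv (projDual_surjective h) l + inclLattice M L ν := rfl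

theorem projDual_splitDual (l : L.Disc) (ν : L.carrier ⧸ M.carrier.submoduleOf L.carrier) :
    projDual h (splitDual h (l, ν)) = l := by
  rw [splitDual_apply, map_add, projDual_inclLattice, add_zero, projDual_surjInv]

/-- Puts ↓ in the coordinates of `splitDual`, so that summing over L'/L as well gives a sum over all
of L'/M. -/
theorem downCoeff_eq
    [Fintype (L.carrier ⧸ M.carrier.submoduleOf L.carrier)]
    (w : M.Disc → ℂ) (l : L.Disc) :
    downCoeff h w l = ∑ ν, w (inclDual h (splitDual h (l, ν))) := by
  have := downCoeff_apply h w (Function.surjInv (projDual_surjective h) l)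
  rw [projDual_surjInv] at this
  simp only [this, splitDual_apply, map_add]

theorem sum_dual_quotient
    [Fintype (L.carrier ⧸ M.carrier.submoduleOf L.carrier)]
    [Fintype (L.dual ⧸ M.carrier.submoduleOf L.dual)]
    (F : (L.dual ⧸ M.carrier.submoduleOf L.dual) → ℂ) :
    ∑ y, F y = ∑ l, ∑ ν, F (splitDual h (l, ν)) := by
  rw [← Equiv.sum_comp (splitDual h), Fintype.sum_prod_type]

theorem sum_eq_sum_inclDual
    [Fintype (L.dual ⧸ M.carrier.submoduleOf L.dual)]
    (F : M.Disc → ℂ) (hF : ∀ m ∉ Set.range (inclDual h), F m = 0) :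
    ∑ m, F m = ∑ y, F (inclDual h y) := by
  classical
  rw [← Finset.sum_subset (Finset.subset_univ (Finset.univ.map ⟨_, inclDual_injective h⟩)),
    Finset.sum_map]
  · rfl
  · intro m _ hm
    exact hF m fun ⟨y, hy⟩ => hm (Finset.mem_map.mpr ⟨y, Finset.mem_univ _, hy⟩)

/-! ### Character sums over L/M and the normalising constants -/

open scoped Classical in
theorem sum_eQZ_inclLattice
    [Fintype (L.carrier ⧸ M.carrier.submoduleOf L.carrier)]
    (m : M.Disc) :
    ∑ ν, eQZ (M.bd m (inclDual h (inclLattice M L ν))) =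
      if m ∈ Set.range (inclDual h) then
        (Fintype.card (L.carrier ⧸ M.carrier.submoduleOf L.carrier) : ℂ) else 0 := by
  let ψ : AddChar (L.carrier ⧸ M.carrier.submoduleOf L.carrier) ℂ :=
    { toFun := fun ν => eQZ (M.bd m (inclDual h (inclLattice M L ν)))
      map_zero_eq_one' := by rw [map_zero, map_zero, M.bd_comm, M.bd_zero_left, eQZ_zero]
      map_add_eq_mul' := fun ν ν' => by rw [map_add, map_add, M.bd_add_right, eQZ_add] }
  have hs := AddChar.sum_eq_ite ψ
  have hψ : ψ = 0 ↔ m ∈ Set.range (inclDual h) := by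
    rw [mem_range_inclDual_iff, DFunLike.ext_iff]
    exact forall_congr' fun ν => eQZ_eq_one_iff _
  simp only [hψ] at hs
  exact hs

theorem card_dual_quotient
    (h : M.carrier ≤ L.carrier)
    [Fintype (L.carrier ⧸ M.carrier.submoduleOf L.carrier)]
    [Fintype (L.dual ⧸ M.carrier.submoduleOf L.dual)] : Fintype.card (L.dual ⧸ M.carrier.submoduleOf L.dual) =
    Fintype.card L.Disc * Fintype.card (L.carrier ⧸ M.carrier.submoduleOf L.carrier) := by
  rw [← Fintype.card_prod, Fintype.card_congr (splitDual h)]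

/-- The index formula `|M'/M| = |L/M|² |L'/L|`. -/
theorem card_disc_eq
    (h : M.carrier ≤ L.carrier)
    [Fintype (L.carrier ⧸ M.carrier.submoduleOf L.carrier)] : Fintype.card M.Disc =
    Fintype.card (L.carrier ⧸ M.carrier.submoduleOf L.carrier) ^ 2 * Fintype.card L.Disc := by
  classical
  have := finite_dual_quotient h
  have := Fintype.ofFinite (L.dual ⧸ M.carrier.submoduleOf L.dual)
  set N := Fintype.card (L.carrier ⧸ M.carrier.submoduleOf L.carrier) with hN
  -- Double counting of ∑ e(β(m, ν)): summing over ν first leaves m in L'/M, summing over m first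
  -- leaves ν = 0.
  have h1 : ∑ m : M.Disc, ∑ ν, eQZ (M.bd m (inclDual h (inclLattice M L ν))) =
      (Fintype.card (L.dual ⧸ M.carrier.submoduleOf L.dual) : ℂ) * N := by
    simp only [sum_eQZ_inclLattice]
    rw [sum_eq_sum_inclDual h]
    · simp [N]
    · exact fun m hm => if_neg hm
  have h2 : ∑ ν, ∑ m : M.Disc, eQZ (M.bd m (inclDual h (inclLattice M L ν))) =
      (Fintype.card M.Disc : ℂ) := by
    simp only [M.bd_comm _ (inclDual h _), M.sum_eQZ_bd]
    have h0 : ∀ ν, inclDual h (inclLattice M L ν) = 0 ↔ ν = 0 := fun ν => by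
      rw [map_eq_zero_iff _ (inclDual_injective h), map_eq_zero_iff _ (inclLattice_injective M L)]
    simp [h0]
  rw [Finset.sum_comm, h2, card_dual_quotient h] at h1
  have h3 : Fintype.card M.Disc = Fintype.card L.Disc * N * N := by exact_mod_cast h1
  rw [h3]
  ring

/-- The phases agree, and the index formula gives √|M'/M| = |L/M| √|L'/L|. -/
theorem weilConst_mul_card
    (h : M.carrier ≤ L.carrier)
    [Fintype (L.carrier ⧸ M.carrier.submoduleOf L.carrier)] :
    M.weilConst * Fintype.card (L.carrier ⧸ M.carrier.submoduleOf L.carrier) = L.weilConst := by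
  set N := Fintype.card (L.carrier ⧸ M.carrier.submoduleOf L.carrier) with hN
  have hL := L.weilConst_mul_sqrt
  have hM := M.weilConst_mul_sqrt
  have hD : (0 : ℝ) < Fintype.card L.Disc := by exact_mod_cast Fintype.card_pos
  have hD' : ((√(Fintype.card L.Disc : ℝ) : ℝ) : ℂ) ≠ 0 := by
    exact_mod_cast (Real.sqrt_pos.mpr hD).ne'
  have hs : √(Fintype.card M.Disc : ℝ) = N * √(Fintype.card L.Disc : ℝ) := by
    rw [card_disc_eq h]
    push_cast
    rw [Real.sqrt_mul (by positivity), Real.sqrt_sq (by positivity)]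
  rw [hs] at hM
  refine mul_right_cancel₀ hD' ?_
  rw [hL]
  refine Eq.trans ?_ hM
  push_cast
  ring

/-! ### The arrow operators on the discriminant groups -/

/-- `↑` and `↓` are adjoint with respect to the standard bilinear pairings. -/
theorem sum_downCoeff_mul (w : M.Disc → ℂ) (v : L.Disc → ℂ) :
    ∑ l, v l * downCoeff h w l = ∑ m, upCoeff h v m * w m := by
  have := finite_lattice_quotient h
  have := Fintype.ofFinite (L.carrier ⧸ M.carrier.submoduleOf L.carrier)
  have := finite_dual_quotient h
  have := Fintype.ofFinite (L.dual ⧸ M.carrier.submoduleOf L.dual)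
  rw [sum_eq_sum_inclDual h _
    (fun m hm => by rw [upCoeff_apply_of_notMem h v m hm, zero_mul]), sum_dual_quotient h]
  simp only [upCoeff_apply, projDual_splitDual, downCoeff_eq, Finset.mul_sum]

theorem upCoeff_weilT (v : L.Disc → ℂ) : upCoeff h (L.weilT v) = M.weilT (upCoeff h v) := by
  funext m
  rw [M.weilT_apply]
  by_cases hm : m ∈ Set.range (inclDual h)
  · obtain ⟨y, rfl⟩ := hm
    rw [upCoeff_apply, upCoeff_apply, L.weilT_apply, qd_inclDual]
  · rw [upCoeff_apply_of_notMem h _ m hm, upCoeff_apply_of_notMem h _ m hm, mul_zero]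

/-- The Fourier sum for M runs over L'/M only. Along each fibre of L'/M → L'/L the vector is
constant, so a full character sum over L/M splits off. It kills m outside L'/M and otherwise
supplies the factor |L/M| of `weilConst_mul_card`. -/
theorem upCoeff_weilS (v : L.Disc → ℂ) : upCoeff h (L.weilS v) = M.weilS (upCoeff h v) := by
  classical
  have := finite_lattice_quotient h
  have := Fintype.ofFinite (L.carrier ⧸ M.carrier.submoduleOf L.carrier)
  have := finite_dual_quotient h
  have := Fintype.ofFinite (L.dual ⧸ M.carrier.submoduleOf L.dual)
  funext m
  rw [M.weilS_apply, sum_eq_sum_inclDual h _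
    (fun m' hm' => by rw [upCoeff_apply_of_notMem h v m' hm', mul_zero]), sum_dual_quotient h]
  -- The minus sign in the kernel is moved onto m, so the ν-factor is the character of -m; the range
  -- of `inclDual` is stable under negation.
  have key : ∀ l ν, eQZ (-M.bd (inclDual h (splitDual h (l, ν))) m) *
      upCoeff h v (inclDual h (splitDual h (l, ν))) =
      (eQZ (-M.bd (inclDual h (Function.surjInv (projDual_surjective h) l)) m) * v l) *
        eQZ (M.bd (-m) (inclDual h (inclLattice M L ν))) := by
    intro l ν
    rw [upCoeff_apply, projDual_splitDual, splitDual_apply, map_add, M.bd_add_left, neg_add,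
      eQZ_add, M.bd_neg_left, M.bd_comm m]
    ring
  simp only [key, ← Finset.mul_sum, sum_eQZ_inclLattice]
  by_cases hm : m ∈ Set.range (inclDual h)
  · obtain ⟨y, rfl⟩ := hm
    have hn : -inclDual h y ∈ Set.range (inclDual h) := ⟨-y, map_neg _ _⟩
    simp only [if_pos hn, upCoeff_apply, L.weilS_apply, ← Finset.sum_mul]
    rw [← weilConst_mul_card h]
    simp only [bd_inclDual, projDual_surjInv]
    ring
  · have hn : -m ∉ Set.range (inclDual h) := fun ⟨y, hy⟩ => hm ⟨-y, by rw [map_neg, hy, neg_neg]⟩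
    simp only [if_neg hn, mul_zero, Finset.sum_const_zero]
    exact upCoeff_apply_of_notMem h _ m hm

/-- The kernel e(-β(l, m)) is symmetric. The pairing is bilinear, without conjugation. -/
theorem EvenLattice.sum_mul_weilS (L : EvenLattice Q) (v w : L.Disc → ℂ) :
    ∑ l, v l * L.weilS w l = ∑ l, L.weilS v l * w l := by
  simp only [L.weilS_apply, Finset.mul_sum, Finset.sum_mul]
  rw [Finset.sum_comm]
  refine Finset.sum_congr rfl fun l _ => Finset.sum_congr rfl fun m _ => ?_
  rw [L.bd_comm]
  ring

theorem EvenLattice.sum_mul_weilT (L : EvenLattice Q) (v w : L.Disc → ℂ) :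
    ∑ l, v l * L.weilT w l = ∑ l, L.weilT v l * w l := by
  simp only [L.weilT_apply]
  exact Finset.sum_congr rfl fun l _ => by ring

theorem eq_of_forall_sum_mul_eq {ι : Type*} [Fintype ι] {v w : ι → ℂ}
    (hvw : ∀ u : ι → ℂ, ∑ i, u i * v i = ∑ i, u i * w i) : v = w := by
  classical
  funext i
  simpa [Pi.single_apply] using hvw (Pi.single i 1)

/-- The transpose of `upCoeff_weilS`, tested against every vector u. -/
theorem downCoeff_weilS (w : M.Disc → ℂ) :
    downCoeff h (M.weilS w) = L.weilS (downCoeff h w) := by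
  refine eq_of_forall_sum_mul_eq fun u => ?_
  rw [sum_downCoeff_mul, M.sum_mul_weilS, ← upCoeff_weilS, ← sum_downCoeff_mul, L.sum_mul_weilS]

theorem downCoeff_weilT (w : M.Disc → ℂ) :
    downCoeff h (M.weilT w) = L.weilT (downCoeff h w) := by
  refine eq_of_forall_sum_mul_eq fun u => ?_
  rw [sum_downCoeff_mul, M.sum_mul_weilT, ← upCoeff_weilT, ← sum_downCoeff_mul, L.sum_mul_weilT]

theorem downCoeff_upCoeff (v : L.Disc → ℂ) : downCoeff h (upCoeff h v) =
    (Nat.card (L.carrier ⧸ M.carrier.submoduleOf L.carrier) : ℂ) • v := by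
  have := finite_lattice_quotient h
  have := Fintype.ofFinite (L.carrier ⧸ M.carrier.submoduleOf L.carrier)
  have := finite_dual_quotient h
  have := Fintype.ofFinite (L.dual ⧸ M.carrier.submoduleOf L.dual)
  funext l
  simp [downCoeff_eq, upCoeff_apply, projDual_splitDual]

/-- A vector supported on `L'/M` and invariant under `L/M` lies in the image of `↑`. -/
theorem upCoeff_downCoeff (w : M.Disc → ℂ) (hw : ∀ m ∉ Set.range (inclDual h), w m = 0)
    (hinv : ∀ m ν, w (m + inclDual h (inclLattice M L ν)) = w m) : upCoeff h (downCoeff h w) =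
    (Nat.card (L.carrier ⧸ M.carrier.submoduleOf L.carrier) : ℂ) • w := by
  have := finite_lattice_quotient h
  have := Fintype.ofFinite (L.carrier ⧸ M.carrier.submoduleOf L.carrier)
  funext m
  by_cases hm : m ∈ Set.range (inclDual h)
  · obtain ⟨y, rfl⟩ := hm
    simp [upCoeff_apply, downCoeff_apply, hinv]
  · rw [upCoeff_apply_of_notMem h _ m hm, Pi.smul_apply, hw m hm, smul_zero]

/-- Translating by ν multiplies the l-th term by e(-β(l, ν)), which is 1 for l in L'/M by
orthogonality; the other terms vanish. -/
theorem weilS_add_inclLattice (w : M.Disc → ℂ) (hw : ∀ m ∉ Set.range (inclDual h), w m = 0)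
    (m : M.Disc) (ν : L.carrier ⧸ M.carrier.submoduleOf L.carrier) :
    M.weilS w (m + inclDual h (inclLattice M L ν)) = M.weilS w m := by
  simp only [M.weilS_apply]
  congr 1
  refine Finset.sum_congr rfl fun l _ => ?_
  by_cases hl : l ∈ Set.range (inclDual h)
  · rw [M.bd_add_right, (mem_range_inclDual_iff h l).mp hl, add_zero]
  · rw [hw l hl, mul_zero, mul_zero]

end Arrows

section Transfer

variable {V : Type*} [AddCommGroup V] [Module ℚ V] {Q : QuadraticForm ℚ V} {M L : EvenLattice Q}

/-! ### Operators commuting with the Weil representations -/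

theorem EvenLattice.T_mem_weilGraph (L : EvenLattice Q) :
    (MpTwoZ.T, L.weilT) ∈ L.weilGraph := Subgroup.subset_closure (Set.mem_insert _ _)

theorem EvenLattice.S_mem_weilGraph (L : EvenLattice Q) :
    (MpTwoZ.S, L.weilS) ∈ L.weilGraph :=
  Subgroup.subset_closure (Set.mem_insert_of_mem _ (Set.mem_singleton _))

/-- The pairs `(γ, A)` under which `f` transforms with weight `κ / 2`. -/
def transformationGroup (L : EvenLattice Q) (κ : ℤ) (f : ℍ → L.Disc → ℂ) :
    Subgroup (MpTwoZ × ((L.Disc → ℂ) ≃ₗ[ℂ] (L.Disc → ℂ))) where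
  carrier := {p | ∀ τ : ℍ, f (p.1.mat • τ) = p.1.root τ ^ κ • p.2 (f τ)}
  one_mem' := by
    intro τ
    rw [Prod.fst_one, Prod.snd_one, MpTwoZ.one_mat, MpTwoZ.one_root, one_smul, one_zpow, one_smul]
    rfl
  mul_mem' := by
    intro p p' hp hp' τ
    rw [Prod.fst_mul, Prod.snd_mul, MpTwoZ.mul_mat, MpTwoZ.mul_root, mul_smul, hp, hp', map_smul,
      smul_smul, mul_zpow]
    rfl
  inv_mem' := by
    intro p hp τ
    have h1 := hp (p.1.mat⁻¹ • τ)
    rw [smul_inv_smul] at h1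
    have h2 : (p⁻¹).2 (p.2 (f (p.1.mat⁻¹ • τ))) = f (p.1.mat⁻¹ • τ) :=
      p.2.symm_apply_apply _
    have h3 : (p⁻¹).1.root τ = (p.1.root (p.1.mat⁻¹ • τ))⁻¹ := rfl
    have h4 : (p⁻¹).1.mat = p.1.mat⁻¹ := rfl
    rw [h1, map_smul, h2, h3, h4, smul_smul, inv_zpow,
      inv_mul_cancel₀ (zpow_ne_zero _ (p.1.root_ne_zero _)), one_smul]

theorem mem_transformationGroup {κ : ℤ} {f : ℍ → L.Disc → ℂ} {γ : MpTwoZ}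
    {A : (L.Disc → ℂ) ≃ₗ[ℂ] (L.Disc → ℂ)} : (γ, A) ∈ transformationGroup L κ f ↔
      ∀ τ : ℍ, f (γ.mat • τ) = γ.root τ ^ κ • A (f τ) := Iff.rfl

/-- The pairs satisfying the transformation law form a subgroup, and the graph of ρ_L is generated
by the pairs of T and S. -/
theorem isModularFunction_iff (L : EvenLattice Q) (κ : ℤ) (f : ℍ → L.Disc → ℂ) :
    IsModularFunction L κ f ↔ (∀ τ : ℍ, f (ModularGroup.T • τ) = L.weilT (f τ)) ∧
      ∀ τ : ℍ, f (ModularGroup.S • τ) = MpTwoZ.S.root τ ^ κ • L.weilS (f τ) := by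
  constructor
  · intro hf
    refine ⟨fun τ => ?_, fun τ => ?_⟩
    · have h1 : MpTwoZ.T.root τ = 1 := rfl
      have h2 : MpTwoZ.T.mat = ModularGroup.T := rfl
      have h3 := hf MpTwoZ.T L.weilT L.T_mem_weilGraph τ
      rwa [h1, h2, one_zpow, one_smul] at h3
    · have h2 : MpTwoZ.S.mat = ModularGroup.S := rfl
      have h3 := hf MpTwoZ.S L.weilS L.S_mem_weilGraph τ
      rwa [h2] at h3
  · rintro ⟨hT, hS⟩
    have hle : L.weilGraph ≤ transformationGroup L κ f := by
      rw [EvenLattice.weilGraph, Subgroup.closure_le]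
      rintro p (rfl | rfl)
      · intro τ
        have h1 : MpTwoZ.T.root τ = 1 := rfl
        have h2 : MpTwoZ.T.mat = ModularGroup.T := rfl
        simp only [h1, h2, one_zpow, one_smul, hT]
      · exact hS
    exact fun γ A hA => mem_transformationGroup.mp (hle hA)

theorem linearMap_apply_eq_sum {ι ι' : Type*} [Fintype ι] [DecidableEq ι]
    (Φ : (ι → ℂ) →ₗ[ℂ] (ι' → ℂ)) (v : ι → ℂ) (m : ι') :
    Φ v m = ∑ l, Φ (Pi.single l 1) m * v l := by
  rw [LinearMap.pi_apply_eq_sum_univ Φ v, Finset.sum_apply]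
  refine Finset.sum_congr rfl fun l _ => ?_
  rw [Pi.smul_apply, smul_eq_mul, mul_comm]
  have h : (fun j => if l = j then (1 : ℂ) else 0) = Pi.single l 1 := by
    funext j
    simp [Pi.single_apply, eq_comm]
  rw [h]

/-- A linear map that commutes with `ρ(T)` and `ρ(S)` preserves modular forms and cusp forms. -/
theorem map_mem_formsSubmodule (Φ : (L.Disc → ℂ) →ₗ[ℂ] (M.Disc → ℂ))
    (hT : ∀ v, Φ (L.weilT v) = M.weilT (Φ v)) (hS : ∀ v, Φ (L.weilS v) = M.weilS (Φ v))
    {κ : ℤ} {p : ℚ → Prop} {f : ℍ → L.Disc → ℂ} (hf : f ∈ formsSubmodule L κ p) :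
    Φ.compLeft ℍ f ∈ formsSubmodule M κ p := by
  classical
  obtain ⟨hmod, hhol, a, ⟨hsupp, hsum⟩, hp⟩ := hf
  rw [isModularFunction_iff] at hmod
  -- A nonzero matrix entry links equal T-eigenvalues e(q(l)) = e(q(m)). This keeps the exponents of
  -- the image in the cosets q(m) + ℤ.
  have hΦ : ∀ l m, Φ (Pi.single l 1) m ≠ 0 → L.qd l = M.qd m := by
    intro l m hne
    have h1 : L.weilT (Pi.single l 1) = eQZ (L.qd l) • Pi.single l (1 : ℂ) := by
      funext j
      rw [L.weilT_apply, Pi.smul_apply, smul_eq_mul]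
      by_cases hj : j = l
      · rw [hj]
      · rw [Pi.single_eq_of_ne hj, mul_zero, mul_zero]
    have h2 := congrFun (hT (Pi.single l 1)) m
    rw [h1, map_smul, Pi.smul_apply, M.weilT_apply, smul_eq_mul] at h2
    exact eQZ_injective (mul_right_cancel₀ hne h2)
  refine ⟨?_, fun m => ?_, fun m n => Φ (fun l => a l n) m, ⟨fun m n hne => ?_, fun τ m => ?_⟩,
    fun m n hn => ?_⟩
  · rw [isModularFunction_iff]
    refine ⟨fun τ => ?_, fun τ => ?_⟩
    · simp only [LinearMap.compLeft_apply, Function.comp_apply, hmod.1, hT]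
    · simp only [LinearMap.compLeft_apply, Function.comp_apply, hmod.2, map_smul, hS]
  · have : (fun τ : ℍ => Φ.compLeft ℍ f τ m) =
        fun τ => ∑ l, Φ (Pi.single l 1) m * f τ l := by
      funext τ
      exact linearMap_apply_eq_sum Φ (f τ) m
    rw [this]
    have hd : ∀ l, DifferentiableOn ℂ ((fun τ : ℍ => f τ l) ∘ UpperHalfPlane.ofComplex)
        {z | 0 < z.im} := fun l => UpperHalfPlane.mdifferentiable_iff.mp (hhol l)
    rw [UpperHalfPlane.mdifferentiable_iff]
    exact DifferentiableOn.fun_sum fun l _ => (hd l).const_mul _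
  · beta_reduce at hne
    rw [linearMap_apply_eq_sum] at hne
    obtain ⟨l, -, hl⟩ := Finset.exists_ne_zero_of_sum_ne_zero hne
    rw [hsupp l n (right_ne_zero_of_mul hl), hΦ l m (left_ne_zero_of_mul hl)]
  · have := hasSum_sum (s := Finset.univ) fun (l : L.Disc) _ =>
      (hsum τ l).mul_left (Φ (Pi.single l 1) m)
    rw [LinearMap.compLeft_apply, Function.comp_apply, linearMap_apply_eq_sum]
    refine this.congr_fun fun n => ?_
    beta_reduce
    rw [linearMap_apply_eq_sum, Finset.sum_mul]
    exact Finset.sum_congr rfl fun l _ => (mul_assoc _ _ _)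
  · have : (fun l => a l n) = 0 := funext fun l => hp l n hn
    beta_reduce
    rw [this, map_zero]
    rfl

theorem upOp_mem (h : M.carrier ≤ L.carrier) {κ : ℤ} {p : ℚ → Prop} {f : ℍ → L.Disc → ℂ}
    (hf : f ∈ formsSubmodule L κ p) : upOp h f ∈ formsSubmodule M κ p :=
  map_mem_formsSubmodule (upCoeff h) (upCoeff_weilT h) (upCoeff_weilS h) hf

theorem downOp_mem (h : M.carrier ≤ L.carrier) {κ : ℤ} {p : ℚ → Prop} {g : ℍ → M.Disc → ℂ}
    (hg : g ∈ formsSubmodule M κ p) : downOp h g ∈ formsSubmodule L κ p :=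
  map_mem_formsSubmodule (downCoeff h) (downCoeff_weilT h) (downCoeff_weilS h) hg

/-- A modular function supported on `L'/M` is invariant under translation by `L/M`. -/
theorem IsModularFunction.add_inclLattice (h : M.carrier ≤ L.carrier) {κ : ℤ}
    {g : ℍ → M.Disc → ℂ} (hg : IsModularFunction M κ g)
    (hsupp : ∀ (τ : ℍ), ∀ m ∉ Set.range (inclDual h), g τ m = 0) (τ : ℍ) (m : M.Disc)
    (ν : L.carrier ⧸ M.carrier.submoduleOf L.carrier) :
    g τ (m + inclDual h (inclLattice M L ν)) = g τ m := by
  -- Exhibits g(τ) as a scalar times ρ(S) of the vector g(S⁻¹τ), which is supported on L'/M.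
  have hS := ((isModularFunction_iff M κ g).mp hg).2 (ModularGroup.S⁻¹ • τ)
  rw [smul_inv_smul] at hS
  rw [hS, Pi.smul_apply, Pi.smul_apply, weilS_add_inclLattice h _ (hsupp _)]

theorem upOp_downOp (h : M.carrier ≤ L.carrier) {κ : ℤ}
    {g : ℍ → M.Disc → ℂ} (hg : IsModularFunction M κ g)
    (hsupp : ∀ (τ : ℍ), ∀ m ∉ Set.range (inclDual h), g τ m = 0) :
    upOp h (downOp h g) =
      (Nat.card (L.carrier ⧸ M.carrier.submoduleOf L.carrier) : ℂ) • g :=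
  funext fun τ => upCoeff_downCoeff h (g τ) (hsupp τ) (hg.add_inclLattice h hsupp τ)

theorem downOp_upOp (h : M.carrier ≤ L.carrier) (f : ℍ → L.Disc → ℂ) :
    downOp h (upOp h f) =
      (Nat.card (L.carrier ⧸ M.carrier.submoduleOf L.carrier) : ℂ) • f :=
  funext fun τ => downCoeff_upCoeff h (f τ)

/-- The entries of ↓ are real, so bilinear adjointness becomes Hermitian adjointness. -/
theorem downCoeff_conj (h : M.carrier ≤ L.carrier) (w : M.Disc → ℂ) (l : L.Disc) :
    conj (downCoeff h w l) = downCoeff h (fun m => conj (w m)) l := by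
  have := finite_lattice_quotient h
  have := Fintype.ofFinite (L.carrier ⧸ M.carrier.submoduleOf L.carrier)
  simp only [downCoeff_eq, map_sum]

theorem peterssonIntegrand_downOp (h : M.carrier ≤ L.carrier) (κ : ℤ) (f : ℍ → L.Disc → ℂ)
    (g : ℍ → M.Disc → ℂ) :
    peterssonIntegrand L κ f (downOp h g) = peterssonIntegrand M κ (upOp h f) g := by
  funext τ
  have := sum_downCoeff_mul h (fun m => conj (g τ m)) (f τ)
  simp only [← downCoeff_conj] at this
  exact congrArg (· * _) this

end Transfer

/-! ### Convergence of the Petersson product -/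

theorem norm_fourierTerm (c : ℂ) (n : ℚ) (τ : ℍ) :
    ‖c * Complex.exp (2 * π * Complex.I * n * τ)‖ = ‖c‖ * Real.exp (-(2 * π * n * τ.im)) := by
  rw [norm_mul, Complex.norm_exp]
  congr 2
  have : (2 * π * Complex.I * n * τ : ℂ) = ((2 * π * n : ℝ) : ℂ) * (Complex.I * τ) := by
    push_cast
    ring
  rw [this, Complex.re_ofReal_mul]
  simp

/-- The absolutely convergent series at τ₀ is a majorant: for n ≥ δ, raising the height from v₀ to v
shrinks each term by at least exp(-2πδ(v - v₀)). Modular forms use δ = 0, cusp forms some δ > 0. -/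
theorem exists_norm_le_of_hasSum {a : ℚ → ℂ} {F : ℍ → ℂ}
    (hF : ∀ τ : ℍ, HasSum (fun n : ℚ => a n * Complex.exp (2 * π * Complex.I * n * τ)) (F τ))
    {δ : ℝ} (hδ : ∀ n : ℚ, a n ≠ 0 → δ ≤ n) (τ₀ : ℍ) :
    ∃ C, 0 ≤ C ∧ ∀ τ : ℍ, τ₀.im ≤ τ.im → ‖F τ‖ ≤ C * Real.exp (-(2 * π * δ * τ.im)) := by
  have hs := (hF τ₀).summable.norm
  refine ⟨Real.exp (2 * π * δ * τ₀.im) *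
    ∑' n : ℚ, ‖a n * Complex.exp (2 * π * Complex.I * n * τ₀)‖, by positivity, fun τ hτ => ?_⟩
  rw [← (hF τ).tsum_eq, mul_right_comm (Real.exp (2 * π * δ * τ₀.im))]
  refine tsum_of_norm_bounded (hs.hasSum.mul_left _) fun n => ?_
  rw [norm_fourierTerm, norm_fourierTerm, ← Real.exp_add, mul_left_comm, ← Real.exp_add]
  by_cases hn : a n = 0
  · simp [hn]
  · refine mul_le_mul_of_nonneg_left (Real.exp_le_exp.mpr ?_) (norm_nonneg _)
    have h1 : 0 ≤ (n - δ) * (τ.im - τ₀.im) :=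
      mul_nonneg (sub_nonneg.mpr (hδ n hn)) (sub_nonneg.mpr hτ)
    nlinarith [Real.pi_pos, mul_nonneg Real.pi_pos.le h1]

/-- For a representative r, the number n · den(r) is a positive integer, so δ = 1/den(r) works; this
makes cusp form decay uniform in n. -/
theorem exists_pos_le_of_coe_eq (r : AddCircle (1 : ℚ)) :
    ∃ δ : ℝ, 0 < δ ∧ ∀ n : ℚ, (n : AddCircle (1 : ℚ)) = r → 0 < n → δ ≤ n := by
  induction r using QuotientAddGroup.induction_on with
  | _ r =>
  have hd : (0 : ℚ) < r.den := by exact_mod_cast r.den_pos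
  refine ⟨((1 / r.den : ℚ) : ℝ), by positivity, fun n hn hpos => ?_⟩
  obtain ⟨k, hk⟩ : ∃ k : ℤ, (k : ℚ) = n - r := by
    have h0 : ((n - r : ℚ) : AddCircle (1 : ℚ)) = 0 := by
      rw [AddCircle.coe_sub, hn]
      exact sub_self _
    obtain ⟨k, hk⟩ := (AddCircle.coe_eq_zero_iff (1 : ℚ)).mp h0
    exact ⟨k, by simpa using hk⟩
  have h1 : n * r.den = ((k * r.den + r.num : ℤ) : ℚ) := by
    push_cast
    rw [hk]
    linear_combination Rat.mul_den_eq_num r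
  have h2 : 0 < k * (r.den : ℤ) + r.num := by
    have : (0 : ℚ) < ((k * r.den + r.num : ℤ) : ℚ) := h1 ▸ mul_pos hpos hd
    exact_mod_cast this
  have h3 : (1 : ℚ) ≤ n * r.den := by
    rw [h1]
    exact_mod_cast h2
  exact_mod_cast (div_le_iff₀ hd).mpr h3

/-- The function tends to 0 at infinity and is continuous on the remaining compact interval; v₀ > 0
allows negative s. -/
theorem exists_rpow_mul_exp_le (s : ℝ) {b v₀ : ℝ} (hb : 0 < b) (hv₀ : 0 < v₀) :
    ∃ K, ∀ v, v₀ ≤ v → v ^ s * Real.exp (-(b * v)) ≤ K := by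
  have ht := tendsto_rpow_mul_exp_neg_mul_atTop_nhds_zero s b hb
  obtain ⟨R, hR⟩ := Filter.eventually_atTop.mp (ht.eventually (gt_mem_nhds one_pos))
  have hc : ContinuousOn (fun v : ℝ => v ^ s * Real.exp (-(b * v))) (Set.Icc v₀ R) := by
    refine ContinuousOn.mul (fun v hv => ?_) (by fun_prop)
    exact (Real.continuousAt_rpow_const v s
      (Or.inl (hv₀.trans_le hv.1).ne')).continuousWithinAt
  obtain ⟨K, hK⟩ := isCompact_Icc.bddAbove_image hc
  refine ⟨max K 1, fun v hv => ?_⟩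
  rcases le_total v R with h | h
  · exact (hK ⟨v, ⟨hv, h⟩, rfl⟩).trans (le_max_left _ _)
  · have := (hR v h).le
    rw [neg_mul] at this
    exact this.trans (le_max_right _ _)

theorem half_le_im_of_mem_fd {τ : ℍ} (hτ : τ ∈ ModularGroup.fd) : 1 / 2 ≤ τ.im := by
  have := ModularGroup.three_le_four_mul_im_sq_of_mem_fd hτ
  nlinarith [τ.im_pos]

/-- The standard fundamental domain has finite hyperbolic volume. -/
theorem volume_fd_lt_top : volume ModularGroup.fd < ⊤ := by
  rw [UpperHalfPlane.volume_eq_lintegral]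
  -- The domain lies in a strip of width 1 on which v⁻² is integrable; 1/4 < 1/2 leaves room for an
  -- open half-line.
  have hsub : ((↑) '' ModularGroup.fd : Set ℂ) ⊆
      Complex.measurableEquivRealProd ⁻¹' (Set.Icc (-(1 / 2)) (1 / 2) ×ˢ Set.Ioi (1 / 4)) := by
    rintro _ ⟨τ, hτ, rfl⟩
    have him := half_le_im_of_mem_fd hτ
    exact ⟨abs_le.mp hτ.2, show (1 / 4 : ℝ) < τ.im by linarith⟩
  refine (lintegral_mono_set hsub).trans_lt ?_
  have hp := Complex.volume_preserving_equiv_real_prod.setLIntegral_comp_preimage_emb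
    Complex.measurableEquivRealProd.measurableEmbedding
    (fun p : ℝ × ℝ => (((1 / ‖p.2‖₊) ^ 2 : NNReal) : ENNReal))
    (Set.Icc (-(1 / 2)) (1 / 2) ×ˢ Set.Ioi (1 / 4))
  refine (le_of_eq hp).trans_lt ?_
  rw [Measure.volume_eq_prod, ← Measure.prod_restrict]
  have h1 : Integrable (fun _ : ℝ => (1 : ℝ)) (volume.restrict (Set.Icc (-(1 / 2)) (1 / 2))) :=
    integrable_const _
  have h2 : Integrable (fun y : ℝ => y ^ (-2 : ℝ)) (volume.restrict (Set.Ioi (1 / 4))) :=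
    integrableOn_Ioi_rpow_of_lt (by norm_num) (by norm_num)
  refine (lintegral_congr fun p => ?_).trans_lt (h1.mul_prod h2).hasFiniteIntegral
  beta_reduce
  rw [one_mul, ← ofReal_norm, ← ENNReal.ofReal_coe_nnreal]
  congr 1
  have : p.2 ^ (-2 : ℝ) = (p.2 ^ 2)⁻¹ := by
    rw [show (-2 : ℝ) = ((-2 : ℤ) : ℝ) by norm_num, Real.rpow_intCast]
    rfl
  rw [this]
  simp

section Petersson

variable {V : Type*} [AddCommGroup V] [Module ℚ V] {Q : QuadraticForm ℚ V}

theorem exists_norm_le_of_mem_modularForms {L : EvenLattice Q} {κ : ℤ} {f : ℍ → L.Disc → ℂ}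
    (hf : f ∈ modularForms L κ) (l : L.Disc) (τ₀ : ℍ) :
    ∃ C, 0 ≤ C ∧ ∀ τ : ℍ, τ₀.im ≤ τ.im → ‖f τ l‖ ≤ C := by
  obtain ⟨-, -, a, ⟨-, hsum⟩, hp⟩ := hf
  obtain ⟨C, hC, h⟩ := exists_norm_le_of_hasSum (fun τ => hsum τ l) (δ := 0)
    (fun n hn => by
      by_contra hlt
      exact hn (hp l n fun h0 => hlt (by exact_mod_cast h0))) τ₀
  exact ⟨C, hC, fun τ hτ => by simpa using h τ hτ⟩

theorem exists_norm_le_of_mem_cuspForms {L : EvenLattice Q} {κ : ℤ} {f : ℍ → L.Disc → ℂ}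
    (hf : f ∈ cuspForms L κ) (l : L.Disc) (τ₀ : ℍ) :
    ∃ C b, 0 ≤ C ∧ 0 < b ∧ ∀ τ : ℍ, τ₀.im ≤ τ.im → ‖f τ l‖ ≤ C * Real.exp (-(b * τ.im)) := by
  obtain ⟨-, -, a, ⟨hsupp, hsum⟩, hp⟩ := hf
  obtain ⟨δ, hδ, hle⟩ := exists_pos_le_of_coe_eq (L.qd l)
  obtain ⟨C, hC, h⟩ := exists_norm_le_of_hasSum (fun τ => hsum τ l) (δ := δ)
    (fun n hn => hle n (hsupp l n hn) (by
      by_contra hlt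
      exact hn (hp l n hlt))) τ₀
  exact ⟨C, 2 * π * δ, hC, by positivity, h⟩

theorem exists_norm_mul_le {L : EvenLattice Q} {κ : ℤ} {f g : ℍ → L.Disc → ℂ}
    (hf : f ∈ modularForms L κ) (hg : g ∈ modularForms L κ)
    (hfg : f ∈ cuspForms L κ ∨ g ∈ cuspForms L κ) (l : L.Disc) (τ₀ : ℍ) :
    ∃ C b, 0 ≤ C ∧ 0 < b ∧ ∀ τ : ℍ, τ₀.im ≤ τ.im →
      ‖f τ l‖ * ‖g τ l‖ ≤ C * Real.exp (-(b * τ.im)) := by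
  rcases hfg with h | h
  · obtain ⟨C, b, hC, hb, h1⟩ := exists_norm_le_of_mem_cuspForms h l τ₀
    obtain ⟨D, hD, h2⟩ := exists_norm_le_of_mem_modularForms hg l τ₀
    refine ⟨C * D, b, mul_nonneg hC hD, hb, fun τ hτ => ?_⟩
    rw [mul_right_comm]
    exact mul_le_mul (h1 τ hτ) (h2 τ hτ) (norm_nonneg _) (by positivity)
  · obtain ⟨C, b, hC, hb, h1⟩ := exists_norm_le_of_mem_cuspForms h l τ₀
    obtain ⟨D, hD, h2⟩ := exists_norm_le_of_mem_modularForms hf l τ₀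
    refine ⟨D * C, b, mul_nonneg hD hC, hb, fun τ hτ => ?_⟩
    rw [mul_assoc]
    exact mul_le_mul (h2 τ hτ) (h1 τ hτ) (norm_nonneg _) hD

theorem continuous_peterssonIntegrand {L : EvenLattice Q} {κ : ℤ} {f g : ℍ → L.Disc → ℂ}
    (hf : f ∈ modularForms L κ) (hg : g ∈ modularForms L κ) :
    Continuous (peterssonIntegrand L κ f g) := by
  have hf' : ∀ l, Continuous fun τ => f τ l := fun l => (hf.2.1 l).continuous
  have hg' : ∀ l, Continuous fun τ => g τ l := fun l => (hg.2.1 l).continuous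
  refine Continuous.mul (continuous_finsetSum _ fun l _ =>
    (hf' l).mul (Complex.continuous_conj.comp (hg' l))) ?_
  exact Complex.continuous_ofReal.comp
    (UpperHalfPlane.continuous_im.rpow_const fun τ => Or.inl τ.im_pos.ne')

/-- The Petersson product of two modular forms converges if one of them is a cusp form. -/
theorem integrableOn_peterssonIntegrand {L : EvenLattice Q} {κ : ℤ} {f g : ℍ → L.Disc → ℂ}
    (hf : f ∈ modularForms L κ) (hg : g ∈ modularForms L κ)
    (hfg : f ∈ cuspForms L κ ∨ g ∈ cuspForms L κ) :
    IntegrableOn (peterssonIntegrand L κ f g) ModularGroup.fd := by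
  -- A point no higher than any point of the fundamental domain, so the bounds above its height hold
  -- on all of it.
  let τ₀ : ℍ := ⟨1 / 2 * Complex.I, by norm_num⟩
  have hτ₀ : τ₀.im = 1 / 2 := by
    change (1 / 2 * Complex.I : ℂ).im = 1 / 2
    norm_num
  choose C b hC hb hle using fun l => exists_norm_mul_le hf hg hfg l τ₀
  choose K hK using fun l =>
    exists_rpow_mul_exp_le ((κ : ℝ) / 2) (hb l) (show (0 : ℝ) < 1 / 2 by norm_num)
  refine IntegrableOn.of_bound volume_fd_lt_top
    (continuous_peterssonIntegrand hf hg).aestronglyMeasurable (∑ l, C l * K l) ?_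
  refine (ae_restrict_iff' ModularGroup.isClosed_fd.measurableSet).mpr (Filter.Eventually.of_forall
    fun τ hτ => ?_)
  have him := half_le_im_of_mem_fd hτ
  have hpow : 0 ≤ τ.im ^ ((κ : ℝ) / 2) := Real.rpow_nonneg τ.im_pos.le _
  rw [peterssonIntegrand, norm_mul, Complex.norm_real, Real.norm_of_nonneg hpow]
  refine (mul_le_mul_of_nonneg_right (norm_sum_le _ _) hpow).trans ?_
  rw [Finset.sum_mul]
  refine Finset.sum_le_sum fun l _ => ?_
  rw [norm_mul, RCLike.norm_conj]
  refine (mul_le_mul_of_nonneg_right (hle l τ (hτ₀.trans_le him)) hpow).trans ?_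
  rw [mul_assoc, mul_comm (Real.exp _)]
  exact mul_le_mul_of_nonneg_left (hK l _ him) (hC l)

end Petersson

/-! ### Theta series -/

/-- Induction on n, splitting off the first coordinate; reduces a diagonal Gaussian sum to
one-dimensional ones. -/
theorem summable_pi_prod {α : Type*} : ∀ {n : ℕ} {f : Fin n → α → ℝ}, (∀ i, 0 ≤ f i) →
    (∀ i, Summable (f i)) → Summable fun k : Fin n → α => ∏ i, f i (k i)
  | 0, _, _, _ => Summable.of_finite
  | n + 1, f, h0, hs => by
    rw [← (Fin.consEquiv fun _ : Fin (n + 1) => α).summable_iff]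
    have ih := summable_pi_prod (fun i : Fin n => h0 i.succ) (fun i => hs i.succ)
    refine ((hs 0).mul_of_nonneg ih (h0 0)
      fun k => Finset.prod_nonneg fun i _ => h0 i.succ (k i)).congr fun p => ?_
    simp [Fin.prod_univ_succ, Fin.consEquiv]

theorem summable_exp_neg_mul_sq {c : ℝ} (hc : 0 < c) :
    Summable fun k : ℤ => Real.exp (-(c * (k : ℝ) ^ 2)) := by
  -- The Jacobi theta bound with no linear term, no polynomial factor and T = c/π.
  refine (summable_pow_mul_jacobiTheta₂_term_bound 0 (div_pos hc Real.pi_pos) 0).congr fun k => ?_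
  rw [pow_zero, one_mul]
  congr 1
  field_simp
  ring

theorem norm_thetaTerm {V : Type*} [AddCommGroup V] [Module ℚ V] (Q : QuadraticForm ℚ V) (τ : ℍ)
    (x : V) : ‖thetaTerm Q τ x‖ = Real.exp (-(2 * π * Q x * τ.im)) := by
  have := norm_fourierTerm 1 (Q x) τ
  rw [one_mul, norm_one, one_mul] at this
  rw [← this, thetaTerm, mul_right_comm]

section Theta

variable {V : Type*} [AddCommGroup V] [Module ℚ V] {Q : QuadraticForm ℚ V}

theorem EvenLattice.finiteDimensional (L : EvenLattice Q) : FiniteDimensional ℚ V := by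
  obtain ⟨n, b, -⟩ := L.exists_basis
  exact b.finiteDimensional_of_finite

theorem polar_weightedSumSquares_single {n : ℕ} (w : Fin n → ℚ) (v : Fin n → ℚ) (i : Fin n) :
    QuadraticMap.polar (QuadraticMap.weightedSumSquares ℚ w) v (Pi.single i 1) =
      2 * w i * v i := by
  simp only [QuadraticMap.polar, QuadraticMap.weightedSumSquares_apply, ← Finset.sum_sub_distrib]
  rw [Finset.sum_eq_single i]
  · simp
    ring
  · intro j _ hj
    simp [hj]
  · simp

/-- For positive definite `Q`, integral coordinates on the dual lattice in which `Q` is diagonal. -/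
theorem EvenLattice.exists_diagonal (L : EvenLattice Q) (hQ : Q.PosDef) :
    ∃ (n : ℕ) (c : Fin n → ℝ) (k : L.dual → Fin n → ℤ), (∀ i, 0 < c i) ∧
      Function.Injective k ∧ ∀ x : L.dual, ((Q (x : V) : ℚ) : ℝ) = ∑ i, c i * (k x i : ℝ) ^ 2 := by
  have := L.finiteDimensional
  obtain ⟨n, w, ⟨φ⟩⟩ : ∃ (n : ℕ) (w : Fin n → ℚ),
      QuadraticMap.Equivalent Q (QuadraticMap.weightedSumSquares ℚ w) :=
    ⟨_, QuadraticForm.equivalent_weightedSumSquares Q⟩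
  have hQφ : ∀ x, Q x = ∑ i, w i * (φ x i * φ x i) := fun x => by
    rw [← φ.map_app x, QuadraticMap.weightedSumSquares_apply]
    rfl
  let e : Fin n → V := fun i => φ.symm (Pi.single i 1)
  have hφe : ∀ i, φ (e i) = Pi.single i 1 := fun i => φ.toLinearEquiv.apply_symm_apply _
  have hw : ∀ i, 0 < w i := by
    intro i
    have hne : e i ≠ 0 := by
      intro h0
      have h1 := hφe i
      have h2 : φ 0 = 0 := φ.toLinearEquiv.map_zero
      rw [h0, h2] at h1
      simpa using congrFun h1 i
    have h1 := hQ (e i) hne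
    rw [hQφ, hφe, Finset.sum_eq_single i] at h1
    · simpa using h1
    · intro j _ hj
      simp [hj]
    · simp
  have hpolar : ∀ x i, QuadraticMap.polar Q x (e i) = 2 * w i * φ x i := by
    intro x i
    rw [← polar_weightedSumSquares_single, ← hφe i]
    have hadd : φ (x + e i) = φ x + φ (e i) := φ.toLinearEquiv.map_add _ _
    simp only [QuadraticMap.polar, ← hadd, φ.map_app]
  -- The orthogonal basis e need not lie in L, but N i • e i does. Pairing with it gives integers k
  -- on L', and k = 2wNφ turns ∑ wφ² into ∑ k²/(4wN²).
  choose N hN0 hN using fun i => L.exists_smul_mem (e i)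
  choose k hk using fun (x : L.dual) i => L.mem_dual.mp x.2 _ (hN i)
  have hk' : ∀ x i, (k x i : ℚ) = 2 * w i * N i * φ x i := by
    intro x i
    rw [← hk x i, ← Int.cast_smul_eq_zsmul ℚ, QuadraticMap.polar_smul_right, hpolar, smul_eq_mul]
    ring
  have hN0' : ∀ i, (N i : ℚ) ≠ 0 := fun i => by exact_mod_cast hN0 i
  have hφk : ∀ (x : L.dual) i, φ x i = k x i / (2 * w i * N i) := by
    intro x i
    have h1 := (hw i).ne'
    have h2 := hN0' i
    rw [hk']
    field_simp
  refine ⟨n, fun i => ((1 / (4 * w i * N i ^ 2) : ℚ) : ℝ), k, fun i => ?_, fun x y hxy => ?_,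
    fun x => ?_⟩
  · have h1 := hw i
    have h2 := hN0' i
    have : (0 : ℚ) < 1 / (4 * w i * N i ^ 2) := by positivity
    beta_reduce
    exact_mod_cast this
  · refine Subtype.ext (φ.toLinearEquiv.injective (funext fun i => ?_))
    exact (hφk x i).trans ((congrArg (fun t : ℤ => (t : ℚ) / (2 * w i * N i))
      (congrFun hxy i)).trans (hφk y i).symm)
  · have : Q (x : V) = ∑ i, 1 / (4 * w i * N i ^ 2) * (k x i : ℚ) ^ 2 := by
      rw [hQφ]
      refine Finset.sum_congr rfl fun i _ => ?_
      have h1 := (hw i).ne'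
      have h2 := hN0' i
      rw [hφk]
      field_simp
      ring
    rw [this]
    push_cast
    rfl

/-- The theta series converge absolutely for positive definite `Q`. -/
theorem EvenLattice.summable_thetaTerm (L : EvenLattice Q) (hQ : Q.PosDef) (τ : ℍ) :
    Summable fun x : L.dual => thetaTerm Q τ x := by
  obtain ⟨n, c, k, hc, hk, hQk⟩ := L.exists_diagonal hQ
  have hs : Summable fun m : Fin n → ℤ =>
      ∏ i, Real.exp (-(2 * π * τ.im * c i * (m i : ℝ) ^ 2)) :=
    summable_pi_prod (f := fun i (m : ℤ) => Real.exp (-(2 * π * τ.im * c i * (m : ℝ) ^ 2)))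
      (fun i m => (Real.exp_pos _).le)
      fun i => summable_exp_neg_mul_sq (mul_pos (mul_pos Real.two_pi_pos τ.im_pos) (hc i))
  refine Summable.of_norm ((hs.comp_injective hk).congr fun x => ?_)
  rw [norm_thetaTerm, hQk, Function.comp_apply, ← Real.exp_sum]
  congr 1
  rw [Finset.sum_neg_distrib, Finset.mul_sum, Finset.sum_mul]
  congr 1
  exact Finset.sum_congr rfl fun i _ => by ring

variable {M L : EvenLattice Q}

/-- The component of `Θ_M` at a class of `L'/M` is a sum over a coset in `L'`. -/
theorem Theta_inclDual (h : M.carrier ≤ L.carrier) (τ : ℍ)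
    (y : L.dual ⧸ M.carrier.submoduleOf L.dual) :
    Theta M τ (inclDual h y) =
      ∑' x : {x : L.dual | Submodule.Quotient.mk x = y}, thetaTerm Q τ (x : L.dual) := by
  let F : {x : L.dual | (Submodule.Quotient.mk x : L.dual ⧸ M.carrier.submoduleOf L.dual) = y} →
      {x : M.dual // M.cls x = inclDual h y} := fun x =>
    ⟨Submodule.inclusion (EvenLattice.dual_anti h) x.1, congrArg (inclDual h) x.2⟩
  have hF : Function.Bijective F := by
    constructor
    · intro x x' hxx
      have h1 : ((x : L.dual) : V) = x' := congrArg
        (fun z : {x : M.dual // M.cls x = inclDual h y} => ((z : M.dual) : V)) hxx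
      exact Subtype.ext (Subtype.ext h1)
    · rintro ⟨x, hx⟩
      induction y using Submodule.Quotient.induction_on with
      | _ y =>
      have h1 : x - Submodule.inclusion (EvenLattice.dual_anti h) y ∈
        M.carrier.submoduleOf M.dual := (Submodule.Quotient.eq _).mp hx
      have h2 : (x : V) - y ∈ M.carrier := h1
      -- The M-coset of a vector of L' stays in L', since M ≤ L ≤ L'.
      have h3 : (x : V) ∈ L.dual := by
        have := add_mem (L.le_dual (h h2)) y.2
        rwa [sub_add_cancel] at this
      exact ⟨⟨⟨x, h3⟩, (Submodule.Quotient.eq _).mpr h2⟩, rfl⟩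
  exact ((Equiv.ofBijective F hF).tsum_eq
    fun x : {x : M.dual // M.cls x = inclDual h y} => thetaTerm Q τ (x : M.dual)).symm

/-- The L-coset l is the disjoint union over ν of the M-cosets `splitDual h (l, ν)`; finitely many
convergent sums over L' are added as indicators. -/
theorem downOp_Theta (h : M.carrier ≤ L.carrier) (hQ : Q.PosDef) :
    downOp h (Theta M) = Theta L := by
  classical
  have := finite_lattice_quotient h
  have := Fintype.ofFinite (L.carrier ⧸ M.carrier.submoduleOf L.carrier)
  funext τ l
  have hs := L.summable_thetaTerm hQ τ
  change downCoeff h (Theta M τ) l =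
    ∑' x : {x : L.dual | L.cls x = l}, thetaTerm Q τ (x : L.dual)
  rw [downCoeff_eq, tsum_subtype {x : L.dual | L.cls x = l} fun x => thetaTerm Q τ x]
  have hT := fun ν => (Theta_inclDual h τ (splitDual h (l, ν))).trans
    (tsum_subtype _ fun x : L.dual => thetaTerm Q τ x)
  rw [Finset.sum_congr rfl fun ν _ => hT ν,
    ← Summable.tsum_finsetSum fun ν _ => hs.indicator _]
  refine tsum_congr fun x => ?_
  -- Each x in L' lies in exactly one M-coset (l', ν'), so at most one ν contributes, and one does
  -- exactly when l' = l.
  obtain ⟨⟨l', ν'⟩, hx⟩ := (splitDual h).surjective (Submodule.Quotient.mk x)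
  have hl : L.cls x = l' := by
    rw [← projDual_splitDual h l' ν', hx]
    rfl
  simp only [Set.indicator_apply, Set.mem_ofPred_eq, hl, ← hx, EmbeddingLike.apply_eq_iff_eq,
    Prod.mk.injEq]
  by_cases hll : l' = l <;> simp [hll]

end Theta

end VVMF

end

/-! ### The operators on spaces of forms -/

theorem mainTheorem2 {V : Type*} [AddCommGroup V] [Module ℚ V] {Q : QuadraticForm ℚ V}
    (M L : VVMF.EvenLattice Q) (h : M.carrier ≤ L.carrier) :
    -- for every weight `k = κ / 2`, the operators restrict to operators on modular forms
    (∀ κ : ℤ,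
      ∃ (down : VVMF.modularForms M κ →ₗ[ℂ] VVMF.modularForms L κ)
        (up : VVMF.modularForms L κ →ₗ[ℂ] VVMF.modularForms M κ),
        (∀ g, (down g : ℍ → L.Disc → ℂ) = VVMF.downOp h g) ∧
        (∀ f, (up f : ℍ → M.Disc → ℂ) = VVMF.upOp h f) ∧
        -- cusp forms are mapped to cusp forms
        (∀ g : VVMF.modularForms M κ, (g : ℍ → M.Disc → ℂ) ∈ VVMF.cuspForms M κ →
          (down g : ℍ → L.Disc → ℂ) ∈ VVMF.cuspForms L κ) ∧
        (∀ f : VVMF.modularForms L κ, (f : ℍ → L.Disc → ℂ) ∈ VVMF.cuspForms L κ →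
          (up f : ℍ → M.Disc → ℂ) ∈ VVMF.cuspForms M κ) ∧
        -- adjointness (both integrals converge), where at least one of the forms is a cusp form
        (∀ (f : VVMF.modularForms L κ) (g : VVMF.modularForms M κ),
          ((f : ℍ → L.Disc → ℂ) ∈ VVMF.cuspForms L κ ∨
            (g : ℍ → M.Disc → ℂ) ∈ VVMF.cuspForms M κ) →
          IntegrableOn (VVMF.peterssonIntegrand L κ f (down g)) ModularGroup.fd ∧
          IntegrableOn (VVMF.peterssonIntegrand M κ (up f) g) ModularGroup.fd ∧
          VVMF.petersson L κ f (down g) = VVMF.petersson M κ (up f) g) ∧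
        -- the image of `↑` consists of the forms supported on `L' / M`
        (∀ g : VVMF.modularForms M κ, g ∈ LinearMap.range up ↔
          ∀ (τ : ℍ) (μ : M.Disc), μ ∉ Set.range (VVMF.inclDual h) →
            (g : ℍ → M.Disc → ℂ) τ μ = 0) ∧
        -- `↓ ∘ ↑ = |L/M| id`, and `↑ ∘ ↓ = |L/M| id` on the image of `↑`
        down ∘ₗ up =
          (Nat.card (L.carrier ⧸ M.carrier.submoduleOf L.carrier) : ℂ) • LinearMap.id ∧
        (∀ g ∈ LinearMap.range up,
          up (down g) = (Nat.card (L.carrier ⧸ M.carrier.submoduleOf L.carrier) : ℂ) • g)) ∧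
    -- in the positive definite case the theta series converge and `↓ Θ_M = Θ_L`
    (Q.PosDef →
      (∀ (τ : ℍ) (μ : M.Disc), Summable fun x : {x : M.dual // M.cls x = μ} =>
        VVMF.thetaTerm Q τ (x : M.dual)) ∧
      (∀ (τ : ℍ) (l : L.Disc), Summable fun x : {x : L.dual // L.cls x = l} =>
        VVMF.thetaTerm Q τ (x : L.dual)) ∧
      VVMF.downOp h (VVMF.Theta M) = VVMF.Theta L) := by
  constructor
  · intro κ
    let down : VVMF.modularForms M κ →ₗ[ℂ] VVMF.modularForms L κ :=
      (VVMF.downOp h).restrict fun _ hg => VVMF.downOp_mem h hg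
    let up : VVMF.modularForms L κ →ₗ[ℂ] VVMF.modularForms M κ :=
      (VVMF.upOp h).restrict fun _ hf => VVMF.upOp_mem h hf
    have hN : (Nat.card (L.carrier ⧸ M.carrier.submoduleOf L.carrier) : ℂ) ≠ 0 := by
      have := VVMF.finite_lattice_quotient h
      exact_mod_cast Nat.card_pos.ne'
    have hsupp : ∀ g ∈ LinearMap.range up, ∀ (τ : ℍ) (μ : M.Disc),
        μ ∉ Set.range (VVMF.inclDual h) → (g : ℍ → M.Disc → ℂ) τ μ = 0 := by
      rintro _ ⟨f, rfl⟩ τ μ hμ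
      exact VVMF.upCoeff_apply_of_notMem h _ μ hμ
    have hud : ∀ g : VVMF.modularForms M κ, (∀ (τ : ℍ) (μ : M.Disc),
        μ ∉ Set.range (VVMF.inclDual h) → (g : ℍ → M.Disc → ℂ) τ μ = 0) →
        up (down g) =
          (Nat.card (L.carrier ⧸ M.carrier.submoduleOf L.carrier) : ℂ) • g :=
      fun g hg => Subtype.ext (VVMF.upOp_downOp h g.2.1 hg)
    refine ⟨down, up, fun _ => rfl, fun _ => rfl, fun g hg => VVMF.downOp_mem h hg,
      fun f hf => VVMF.upOp_mem h hf, fun f g hfg => ?_, fun g => ⟨hsupp g, fun hg => ?_⟩,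
      LinearMap.ext fun f => Subtype.ext (VVMF.downOp_upOp h f), fun g hg => hud g (hsupp g hg)⟩
    · have heq : VVMF.peterssonIntegrand L κ f (down g) =
          VVMF.peterssonIntegrand M κ (up f) g := VVMF.peterssonIntegrand_downOp h κ f g
      have hint : IntegrableOn (VVMF.peterssonIntegrand M κ (up f) g) ModularGroup.fd :=
        VVMF.integrableOn_peterssonIntegrand (up f).2 g.2
          (hfg.imp_left fun hf => VVMF.upOp_mem h hf)
      refine ⟨heq ▸ hint, hint, ?_⟩
      rw [VVMF.petersson, VVMF.petersson, heq]
    -- The preimage is forced by ↓∘↑ = |L/M|, and ↑∘↓ = |L/M| on forms supported on L'/M shows that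
    -- it works.
    · refine ⟨(Nat.card (L.carrier ⧸ M.carrier.submoduleOf L.carrier) : ℂ)⁻¹ • down g, ?_⟩
      rw [map_smul, hud g hg, smul_smul, inv_mul_cancel₀ hN, one_smul]
  · exact fun hQ => ⟨fun τ μ => (M.summable_thetaTerm hQ τ).comp_injective Subtype.val_injective,
      fun τ l => (L.summable_thetaTerm hQ τ).comp_injective Subtype.val_injective,
      VVMF.downOp_Theta h hQ⟩
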